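/- **Theorem (SLLN).** Let $X_1,X_2,\dots$ be i.i.d. random variables with values in $\{1,2,\dots\}$ such that $p_i:=\mathbb P(X_1=i)>0$ and $p_i\ge p_{i+1}$ for all $i\ge1$; $X_m$ is the label of the urn hit by ball number $m$. Assume the regularity condition $$\alpha(x):=\max\{i>0:\ p_i\ge 1/x\}=x^{\theta}L(x),\qquad x>0,$$ (with $\max\emptyset:=0$) for some $\theta\in(0,1]$ and some function $L$ that is slowly varying at infinity, i.e. measurable, eventually positive, and such that $L(cx)/L(x)\to1$ as $x\to\infty$ for every $c>0$. For $A\subseteq[0,1]$ and integers $n,k\ge1$ put $nA=\{na: a\in A\}$, let $R^*_{nA,k}$ be the number of urns $i\ge 1$ that contain at least $k$ balls with indices in $nA$, that is, the number of $i\ge1$ for which there are at least $k$ integers $m\ge1$ with $m\in nA$ and $X_m=i$, and let $R_{nA,k}:=R^*_{nA,k}-R^*_{nA,k+1}$ be the number of urns that contain exactly $k$ such balls. Let $k\ge1$, and let $A\subseteq[0,1]$ be a finite union of intervals (open, closed or half-open) and points, with Lebesgue measure $|A|>0$. Then almost surely, as $n\to\infty$, $$\frac{R^*_{nA,k}}{\mathbb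 E R^*_{nA,k}}\to1,\qquad \frac{R_{nA,k}}{\mathbb E R_{nA,k}}\to1 .$$ -/

import Mathlib

open MeasureTheory ProbabilityTheory Filter Topology

noncomputable section

namespace UrnScheme

/-- The dilation `tA = {ta : a ∈ A}`. -/
def dilate (t : ℝ) (A : Set ℝ) : Set ℝ := (fun a => t * a) '' A

/-- The set of (positive) indices of the balls that lie in the index set `S ⊆ ℝ` and hit urn `i`,
when ball number `m` hits the urn `x m`. -/
def ballsIn (x : ℕ+ → ℕ) (S : Set ℝ) (i : ℕ) : Set ℕ+ := {m | (m : ℝ) ∈ S ∧ x m = i}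

/-- The number of urns `i ≥ 1` that contain at least `k` balls with indices in `S`. -/
def urnsAtLeast (x : ℕ+ → ℕ) (S : Set ℝ) (k : ℕ) : ℕ :=
  Set.ncard {i : ℕ | 1 ≤ i ∧ (k : ℕ∞) ≤ (ballsIn x S i).encard}

variable {Ω : Type*}

/-- The statistic `R*_{nA,k}`: the number of urns that contain at least `k` balls with
indices in `nA`. -/
def RStar (X : ℕ+ → Ω → ℕ) (A : Set ℝ) (k n : ℕ) (ω : Ω) : ℝ :=
  (urnsAtLeast (fun m => X m ω) (dilate n A) k : ℝ)

/-- The statistic `R_{nA,k} = R*_{nA,k} - R*_{nA,k+1}`: the number of urns that contain exactly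
`k` balls with indices in `nA`. -/
def RExact (X : ℕ+ → Ω → ℕ) (A : Set ℝ) (k n : ℕ) (ω : Ω) : ℝ :=
  RStar X A k n ω - RStar X A (k + 1) n ω

/-- The probability `p_i = P(X_1 = i)` that a ball hits urn `i`. -/
def urnProb [MeasurableSpace Ω] (μ : Measure Ω) (X : ℕ+ → Ω → ℕ) (i : ℕ) : ℝ :=
  μ.real {ω | X 1 ω = i}

/-- The infinite urn scheme: the `X_m` are i.i.d. positive integer-valued random variables, every
urn `i ≥ 1` is hit with positive probability `p_i`, and `p_i ≥ p_{i+1}` for `i ≥ 1`. -/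
structure IsUrnScheme [MeasurableSpace Ω] (μ : Measure Ω) (X : ℕ+ → Ω → ℕ) : Prop where
  measurable : ∀ m, Measurable (X m)
  pos : ∀ m ω, 1 ≤ X m ω
  indep : iIndepFun X μ
  ident : ∀ m, IdentDistrib (X m) (X 1) μ μ
  prob_pos : ∀ i, 1 ≤ i → 0 < urnProb μ X i
  prob_anti : ∀ i, 1 ≤ i → urnProb μ X (i + 1) ≤ urnProb μ X i

/-- Slow variation at infinity. -/
def SlowlyVarying (L : ℝ → ℝ) : Prop :=
  Measurable L ∧ (∀ᶠ x in atTop, 0 < L x) ∧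
    ∀ c : ℝ, 0 < c → Tendsto (fun x => L (c * x) / L x) atTop (𝓝 1)

/-- `α(x) = max {i > 0 : p_i ≥ 1/x}` (and `0` if there is no such `i`). -/
def countFun (p : ℕ → ℝ) (x : ℝ) : ℕ := sSup {i : ℕ | 0 < i ∧ 1 / x ≤ p i}

/-- Regularity condition with exponent `θ`: `θ ∈ [0,1]` and `α(x) = x^θ L(x)` with `L` slowly
varying. -/
def RegularCondition (p : ℕ → ℝ) (θ : ℝ) : Prop :=
  θ ∈ Set.Icc (0 : ℝ) 1 ∧
    ∃ L : ℝ → ℝ, SlowlyVarying L ∧ ∀ x : ℝ, 0 < x → (countFun p x : ℝ) = x ^ θ * L x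

/-- Finite unions of intervals contained in `[0,1]`. The intervals (order-convex sets) may be open,
closed or half-open, and may degenerate to single points. -/
def IsFiniteUnionOfIntervals (A : Set ℝ) : Prop :=
  ∃ F : Set (Set ℝ), F.Finite ∧ (∀ I ∈ F, I.OrdConnected ∧ I ⊆ Set.Icc 0 1) ∧ A = ⋃₀ F

end UrnScheme

end

/-! Let f_k(N) be the mean number of urns with at least k of N given balls (`meanOcc`); the
expectations in question depend on nA only through the number N of indices in it. Three facts carry
the proof. Concentration: loads of different urns are negatively correlated
(`measureReal_le_load_inter_le`), so the variance of the count is at most its mean and the mean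
square relative error is at most 1/f_k. Growth: since θ > 0, regular variation forces α(N), and with
it f_k(N), to be at least of order N^(θ/2) (`exists_rpow_le_meanOcc`). Smoothness: f_k(N) divided by
N(N-1)...(N-k+1) is nonincreasing for N ≥ k (`meanOcc_mul_descFactorial_le`), so changing N by a
factor 1 + o(1) changes f_k by such a factor only.

Along n = j^r with r ≥ 4/θ the mean square errors are summable, which gives almost sure convergence.
The sets nA are not nested, so the gaps are filled by sandwiching: for n in [j^r, (j+1)^r], nA lies
between the intersection and the union of these dilations. Those two sets differ only near dilated
endpoints of the intervals, by O((j+1)^r - j^r + 1) = o(j^r) indices (`exists_card_upperIdx_le`).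
The number of urns with at least k balls is monotone in the index set, so the law of large numbers
for both bounds squeezes it.

The number with exactly k balls is not monotone, but it is a difference of two counts already
handled. Nothing is lost by cancellation, because f_k ≤ C (f_k - f_{k+1}) eventually
(`exists_meanOcc_le_mul_sub`). -/

namespace UrnScheme

/-! ### Binomial tails -/

/-- The probability that a binomial variable with parameters `n` and `p` is at least `k`. -/
noncomputable def binTail (p : ℝ) : ℕ → ℕ → ℝ
  | _, 0 => 1
  | 0, _ + 1 => 0
  | n + 1, k + 1 => p * binTail p n k + (1 - p) * binTail p n (k + 1)

lemma binTail_zero_right (p : ℝ) (n : ℕ) : binTail p n 0 = 1 := by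
  cases n <;> simp [binTail]

lemma binTail_succ (p : ℝ) (n k : ℕ) :
    binTail p (n + 1) k = p * binTail p n (k - 1) + (1 - p) * binTail p n k := by
  cases k with
  | zero => simp [binTail_zero_right]
  | succ k => simp [binTail]

lemma binTail_nonneg {p : ℝ} (h0 : 0 ≤ p) (h1 : p ≤ 1) (n k : ℕ) : 0 ≤ binTail p n k := by
  induction n generalizing k with
  | zero => cases k <;> simp [binTail]
  | succ n ih =>
    rw [binTail_succ]
    have := ih (k - 1)
    have := ih k
    have : 0 ≤ 1 - p := by linarith
    positivity

lemma binTail_le_one {p : ℝ} (h0 : 0 ≤ p) (h1 : p ≤ 1) (n k : ℕ) : binTail p n k ≤ 1 := by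
  induction n generalizing k with
  | zero => cases k <;> simp [binTail]
  | succ n ih =>
    rw [binTail_succ]
    have := mul_le_mul_of_nonneg_left (ih (k - 1)) h0
    have := mul_le_mul_of_nonneg_left (ih k) (sub_nonneg.2 h1)
    linarith

lemma binTail_sub_succ (p : ℝ) (n k : ℕ) :
    binTail p n k - binTail p n (k + 1) = n.choose k * p ^ k * (1 - p) ^ (n - k) := by
  induction n generalizing k with
  | zero => cases k <;> simp [binTail]
  | succ n ih =>
    cases k with
    | zero =>
      have := ih 0
      simp only [binTail, binTail_zero_right] at *
      simp only [zero_add, Nat.choose_zero_right, Nat.cast_one, pow_zero, mul_one, Nat.sub_zero,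
        one_mul] at *
      rw [pow_succ, ← this]; ring
    | succ k =>
      have h1 := ih k
      have h2 := ih (k + 1)
      have h3 : binTail p (n + 1) (k + 1) - binTail p (n + 1) (k + 1 + 1) =
          p * (binTail p n k - binTail p n (k + 1)) +
          (1 - p) * (binTail p n (k + 1) - binTail p n (k + 1 + 1)) := by
        simp only [binTail]; ring
      rw [h3, h1, h2, Nat.choose_succ_succ, Nat.add_sub_add_right]
      rcases lt_or_ge k n with h | h
      · obtain ⟨d, rfl⟩ := Nat.exists_eq_add_of_lt h
        have e1 : k + d + 1 - k = d + 1 := by omega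
        have e2 : k + d + 1 - (k + 1) = d := by omega
        rw [e1, e2]; push_cast; ring
      -- For n ≤ k the truncated exponent n - (k + 1) is harmless: its binomial coefficient
      -- vanishes.
      · rw [Nat.choose_eq_zero_of_lt (Nat.lt_succ_of_le h)]
        push_cast; ring

lemma binTail_succ_le {p : ℝ} (h0 : 0 ≤ p) (h1 : p ≤ 1) (n k : ℕ) :
    binTail p n (k + 1) ≤ binTail p n k := by
  have := binTail_sub_succ p n k
  have h : 0 ≤ 1 - p := sub_nonneg.2 h1
  have : 0 ≤ (n.choose k : ℝ) * p ^ k * (1 - p) ^ (n - k) := by positivity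
  linarith

lemma binTail_le_pred {p : ℝ} (h0 : 0 ≤ p) (h1 : p ≤ 1) (n k : ℕ) :
    binTail p n k ≤ binTail p n (k - 1) := by
  cases k with
  | zero => rfl
  | succ k => exact binTail_succ_le h0 h1 n k

/-- Union bound over the k-element sets of trials. -/
lemma binTail_le_choose {p : ℝ} (h0 : 0 ≤ p) (h1 : p ≤ 1) (n k : ℕ) :
    binTail p n k ≤ n.choose k * p ^ k := by
  induction n generalizing k with
  | zero => cases k <;> simp [binTail]
  | succ n ih =>
    cases k with
    | zero => simp [binTail]
    | succ k =>
      simp only [binTail]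
      have e1 := mul_le_mul_of_nonneg_left (ih k) h0
      have e2 := ih (k + 1)
      have e3 := mul_nonneg h0 (binTail_nonneg h0 h1 n (k + 1))
      rw [Nat.choose_succ_succ]
      push_cast
      have : p * (n.choose k * p ^ k) + n.choose (k + 1) * p ^ (k + 1)
        = ((n.choose k : ℝ) + n.choose (k + 1)) * p ^ (k + 1) := by ring
      linarith

/-- Delete one of n + 1 trials uniformly at random: the success count falls below k exactly when it
was k and a success is deleted, which has conditional probability k / (n + 1). -/
lemma succ_mul_binTail_succ_sub (p : ℝ) (n k : ℕ) :
    ((n : ℝ) + 1) * (binTail p (n + 1) k - binTail p n k) =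
      k * (binTail p (n + 1) k - binTail p (n + 1) (k + 1)) := by
  cases k with
  | zero => simp [binTail_zero_right]
  | succ k =>
    rw [binTail_sub_succ]
    have : binTail p (n + 1) (k + 1) - binTail p n (k + 1) =
        p * (binTail p n k - binTail p n (k + 1)) := by simp only [binTail]; ring
    rw [this, binTail_sub_succ, Nat.add_sub_add_right]
    have h : ((n : ℝ) + 1) * n.choose k = (n + 1).choose (k + 1) * ((k : ℝ) + 1) := by
      exact_mod_cast Nat.add_one_mul_choose_eq n k
    push_cast
    linear_combination p * p ^ k * (1 - p) ^ (n - k) * h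

lemma binTail_le_succ {p : ℝ} (h0 : 0 ≤ p) (h1 : p ≤ 1) (n k : ℕ) :
    binTail p n k ≤ binTail p (n + 1) k := by
  rw [binTail_succ]
  have := mul_le_mul_of_nonneg_left (binTail_le_pred h0 h1 n k) h0
  linarith

lemma exp_neg_le_one_sub_pow {p : ℝ} (h0 : 0 ≤ p) (h1 : p ≤ 1 / 2) (n : ℕ) :
    Real.exp (-(2 * p) * n) ≤ (1 - p) ^ n := by
  have hp : 0 < 1 - p := by linarith
  have h : -(2 * p) ≤ Real.log (1 - p) := by
    refine le_trans ?_ (Real.one_sub_inv_le_log_of_pos hp)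
    rw [le_sub_iff_add_le, ← le_sub_iff_add_le', inv_le_comm₀ hp (by linarith),
      inv_le_iff_one_le_mul₀ (by linarith)]
    nlinarith
  calc Real.exp (-(2 * p) * n) ≤ Real.exp (Real.log (1 - p) * n) := by gcongr
    _ = (1 - p) ^ n := by rw [mul_comm, Real.exp_nat_mul, Real.exp_log hp]

/-- When `np ≤ 2`, the binomial tail is comparable with its first term. -/
lemma binTail_le_exp_mul_sub {p : ℝ} {n : ℕ} (h0 : 0 ≤ p) (hn : 4 ≤ n) (h2 : n * p ≤ 2) (k : ℕ) :
    Real.exp (-4) * (n.choose k * p ^ k) ≤ binTail p n k - binTail p n (k + 1) := by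
  have hn' : (4 : ℝ) ≤ n := by exact_mod_cast hn
  have hp : p ≤ 1 / 2 := by nlinarith
  have h := exp_neg_le_one_sub_pow h0 hp n
  rw [binTail_sub_succ, mul_comm]
  gcongr
  calc Real.exp (-4) ≤ Real.exp (-(2 * p) * n) := by
        rw [Real.exp_le_exp]; linarith
    _ ≤ (1 - p) ^ n := h
    _ ≤ (1 - p) ^ (n - k) :=
      pow_le_pow_of_le_one (by linarith) (by linarith) (Nat.sub_le _ _)

/-! ### Mean occupancy counts and their smoothness in the number of balls -/

/-- The expected number of urns with at least `k` balls after `n` throws. -/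
noncomputable def meanOcc (p : ℕ → ℝ) (k n : ℕ) : ℝ := ∑' i, binTail (p i) n k

/-- The properties of the urn probabilities, extended by `p 0 = 0`, used throughout. -/
structure IsUrnProb (p : ℕ → ℝ) : Prop where
  zero : p 0 = 0
  pos : ∀ i, 1 ≤ i → 0 < p i
  le_one : ∀ i, p i ≤ 1
  anti : ∀ i, 1 ≤ i → p (i + 1) ≤ p i
  summable : Summable p

namespace IsUrnProb

variable {p : ℕ → ℝ}

lemma nonneg (hp : IsUrnProb p) (i : ℕ) : 0 ≤ p i := by
  cases i with
  | zero => exact hp.zero.ge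
  | succ i => exact (hp.pos _ (by omega)).le

lemma summable_binTail (hp : IsUrnProb p) {k : ℕ} (hk : 1 ≤ k) (n : ℕ) :
    Summable fun i => binTail (p i) n k := by
  refine Summable.of_nonneg_of_le (fun i => binTail_nonneg (hp.nonneg i) (hp.le_one i) n k)
    (fun i => ?_) (hp.summable.mul_left (n.choose k : ℝ))
  refine (binTail_le_choose (hp.nonneg i) (hp.le_one i) n k).trans ?_
  gcongr
  exact pow_le_of_le_one (hp.nonneg i) (hp.le_one i) (by omega)

lemma meanOcc_nonneg (hp : IsUrnProb p) (k n : ℕ) : 0 ≤ meanOcc p k n :=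
  tsum_nonneg fun i => binTail_nonneg (hp.nonneg i) (hp.le_one i) n k

lemma meanOcc_mono (hp : IsUrnProb p) {k : ℕ} (hk : 1 ≤ k) : Monotone (meanOcc p k) :=
  monotone_nat_of_le_succ fun n => (hp.summable_binTail hk n).tsum_le_tsum
    (fun i => binTail_le_succ (hp.nonneg i) (hp.le_one i) n k) (hp.summable_binTail hk _)

lemma meanOcc_succ_le (hp : IsUrnProb p) {k : ℕ} (hk : 1 ≤ k) (n : ℕ) :
    meanOcc p (k + 1) n ≤ meanOcc p k n :=
  (hp.summable_binTail (by omega) n).tsum_le_tsum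
    (fun i => binTail_succ_le (hp.nonneg i) (hp.le_one i) n k) (hp.summable_binTail hk _)

/-- Sum `succ_mul_binTail_succ_sub` over the urns and drop the nonnegative term with k + 1. This is
one step of the monotonicity of f_k(n) / (n)_k. -/
lemma mul_meanOcc_succ_le (hp : IsUrnProb p) {k : ℕ} (hk : 1 ≤ k) (n : ℕ) :
    ((n : ℝ) + 1 - k) * meanOcc p k (n + 1) ≤ (n + 1) * meanOcc p k n := by
  unfold meanOcc
  rw [← tsum_mul_left, ← tsum_mul_left]
  refine ((hp.summable_binTail hk _).mul_left _).tsum_le_tsum (fun i => ?_)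
    ((hp.summable_binTail hk _).mul_left _)
  have h1 := succ_mul_binTail_succ_sub (p i) n k
  have h2 := mul_nonneg (Nat.cast_nonneg (α := ℝ) k)
    (binTail_nonneg (hp.nonneg i) (hp.le_one i) (n + 1) (k + 1))
  linarith

lemma meanOcc_mul_descFactorial_le (hp : IsUrnProb p) {k : ℕ} (hk : 1 ≤ k) {n m : ℕ} (hn : k ≤ n)
    (hm : n ≤ m) :
    meanOcc p k m * n.descFactorial k ≤ meanOcc p k n * m.descFactorial k := by
  induction m, hm using Nat.le_induction with
  | base => rfl
  | succ m hm ih =>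
    have h1 := hp.mul_meanOcc_succ_le hk m
    have h2 : ((m : ℝ) + 1 - k) * (m + 1).descFactorial k = (m + 1) * m.descFactorial k := by
      have := Nat.succ_descFactorial m k
      rw [← Nat.cast_inj (R := ℝ)] at this
      push_cast [Nat.cast_sub (show k ≤ m + 1 by omega)] at this
      exact this
    have h3 : (0 : ℝ) < (m : ℝ) + 1 - k := by
      have : (k : ℝ) ≤ m := by exact_mod_cast hn.trans hm
      linarith
    refine le_of_mul_le_mul_left ?_ h3
    calc ((m : ℝ) + 1 - k) * (meanOcc p k (m + 1) * n.descFactorial k)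
        = (((m : ℝ) + 1 - k) * meanOcc p k (m + 1)) * n.descFactorial k := by ring
      _ ≤ ((m + 1) * meanOcc p k m) * n.descFactorial k := by gcongr
      _ = (m + 1) * (meanOcc p k m * n.descFactorial k) := by ring
      _ ≤ (m + 1) * (meanOcc p k n * m.descFactorial k) := by gcongr
      _ = ((m : ℝ) + 1 - k) * (meanOcc p k n * (m + 1).descFactorial k) := by
        linear_combination (-meanOcc p k n) * h2

/-- A growth bound free of any regularity condition. The factor tends to 1 whenever m / n does and n
→ ∞, which is what interpolation between the blocks needs. -/
lemma meanOcc_le_mul_pow (hp : IsUrnProb p) {k : ℕ} (hk : 1 ≤ k) {n m : ℕ} (hn : k ≤ n)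
    (hm : n ≤ m) : meanOcc p k m ≤ meanOcc p k n * ((m : ℝ) / (n + 1 - k)) ^ k := by
  have h := hp.meanOcc_mul_descFactorial_le hk hn hm
  have h3 : (0 : ℝ) < (n : ℝ) + 1 - k := by
    have : (k : ℝ) ≤ n := by exact_mod_cast hn
    linarith
  have h1 : ((n : ℝ) + 1 - k) ^ k ≤ n.descFactorial k := by
    have := Nat.pow_sub_le_descFactorial n k
    rw [← Nat.cast_le (α := ℝ)] at this
    push_cast [Nat.cast_sub (show k ≤ n + 1 by omega)] at this
    exact this
  have h2 : (m.descFactorial k : ℝ) ≤ m ^ k := by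
    exact_mod_cast Nat.descFactorial_le_pow m k
  rw [div_pow, ← mul_div_assoc, le_div_iff₀ (by positivity)]
  calc meanOcc p k m * ((n : ℝ) + 1 - k) ^ k ≤ meanOcc p k m * n.descFactorial k := by
        gcongr; exact hp.meanOcc_nonneg _ _
    _ ≤ meanOcc p k n * m.descFactorial k := h
    _ ≤ _ := by gcongr; exact hp.meanOcc_nonneg _ _

end IsUrnProb

end UrnScheme

/-! ### Consequences of regular variation -/

namespace UrnScheme

namespace IsUrnProb

variable {p : ℕ → ℝ}

lemma anti_le (hp : IsUrnProb p) {i j : ℕ} (hi : 1 ≤ i) (hij : i ≤ j) : p j ≤ p i := by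
  induction j, hij using Nat.le_induction with
  | base => rfl
  | succ j hj ih => exact (hp.anti j (hi.trans hj)).trans ih

lemma finite_le (hp : IsUrnProb p) {x : ℝ} (hx : 0 < x) : {i : ℕ | 0 < i ∧ 1 / x ≤ p i}.Finite := by
  have h := hp.summable.tendsto_cofinite_zero.eventually (gt_mem_nhds (one_div_pos.2 hx))
  rw [Filter.eventually_cofinite] at h
  exact h.subset fun i hi => not_lt.2 hi.2

lemma le_countFun_iff (hp : IsUrnProb p) {x : ℝ} (hx : 0 < x) {i : ℕ} (hi : 1 ≤ i) :
    i ≤ countFun p x ↔ 1 / x ≤ p i := by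
  have hfin := hp.finite_le hx
  constructor
  · intro h
    have hne : {i : ℕ | 0 < i ∧ 1 / x ≤ p i}.Nonempty := by
      by_contra hne
      rw [Set.not_nonempty_iff_eq_empty] at hne
      rw [countFun, hne] at h
      simp at h
      omega
    exact (Nat.sSup_mem hne hfin.bddAbove).2.trans (hp.anti_le hi h)
  · intro h
    exact le_csSup hfin.bddAbove ⟨hi, h⟩

lemma countFun_mono (hp : IsUrnProb p) {x y : ℝ} (hx : 0 < x) (hxy : x ≤ y) :
    countFun p x ≤ countFun p y := by
  rcases Nat.eq_zero_or_pos (countFun p x) with h | h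
  · omega
  · rw [hp.le_countFun_iff (hx.trans_le hxy) h]
    exact (one_div_le_one_div_of_le hx hxy).trans ((hp.le_countFun_iff hx h).1 le_rfl)

end IsUrnProb

/-- The ratio α(2x) / α(x) tends to 2^θ; halving the exponent leaves a margin that absorbs the
slowly varying factor. -/
lemma RegularCondition.eventually_le {p : ℕ → ℝ} {θ : ℝ} (hθ : 0 < θ) (h : RegularCondition p θ) :
    ∀ᶠ x : ℝ in atTop, (2 : ℝ) ^ (θ / 2) * countFun p x ≤ countFun p (2 * x) := by
  obtain ⟨-, L, ⟨-, hpos, hL⟩, hα⟩ := h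
  have h1 : (2 : ℝ) ^ (-(θ / 2)) < 1 :=
    Real.rpow_lt_one_of_one_lt_of_neg (by norm_num) (by linarith)
  filter_upwards [hpos, (hL 2 two_pos).eventually (lt_mem_nhds h1), eventually_gt_atTop 0]
    with x hx hx2 hx0
  rw [hα x hx0, hα (2 * x) (by positivity)]
  rw [lt_div_iff₀ hx] at hx2
  rw [Real.mul_rpow two_pos.le hx0.le]
  have e : (2 : ℝ) ^ (θ / 2) = 2 ^ θ * 2 ^ (-(θ / 2)) := by
    rw [← Real.rpow_add two_pos]; congr 1; ring
  rw [e]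
  calc (2 : ℝ) ^ θ * 2 ^ (-(θ / 2)) * (x ^ θ * L x)
      = 2 ^ θ * x ^ θ * (2 ^ (-(θ / 2)) * L x) := by ring
    _ ≤ _ := by gcongr

namespace IsUrnProb

variable {p : ℕ → ℝ} {θ : ℝ}

/-- Polynomial growth of the counting function. -/
lemma exists_rpow_le_countFun (hp : IsUrnProb p) (hθ : 0 < θ) (h : RegularCondition p θ) :
    ∃ c : ℝ, 0 < c ∧ ∀ᶠ x : ℝ in atTop, c * x ^ (θ / 2) ≤ countFun p x := by
  obtain ⟨x₁, hx₁⟩ := eventually_atTop.1 (h.eventually_le hθ)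
  have hp1 : 0 < p 1 := hp.pos 1 le_rfl
  -- The bound 1 / p 1 makes α(x₀) ≥ 1, so that iterated doubling starts from a positive value.
  set x₀ := max x₁ (1 / p 1) with hx₀
  have hx0 : 0 < x₀ := lt_of_lt_of_le (by positivity) (le_max_right _ _)
  have hpow : ∀ j : ℕ, ((2 : ℝ) ^ (θ / 2)) ^ j ≤ countFun p (2 ^ j * x₀) := by
    intro j
    induction j with
    | zero =>
      have : 1 ≤ countFun p x₀ := by
        rw [hp.le_countFun_iff hx0 le_rfl, one_div_le hx0 hp1]
        exact le_max_right _ _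
      simpa using this
    | succ j ih =>
      have h2 : x₁ ≤ 2 ^ j * x₀ := by
        have h3 : (1 : ℝ) ≤ 2 ^ j := one_le_pow₀ (by norm_num)
        nlinarith [le_max_left x₁ (1 / p 1)]
      have h4 := hx₁ _ h2
      rw [pow_succ', pow_succ', mul_assoc]
      refine le_trans ?_ h4
      gcongr
  refine ⟨(1 / (2 * x₀)) ^ (θ / 2), by positivity, ?_⟩
  filter_upwards [eventually_ge_atTop x₀] with x hx
  obtain ⟨j, hj1, hj2⟩ := exists_nat_pow_near ((one_le_div hx0).2 hx) (one_lt_two (α := ℝ))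
  rw [le_div_iff₀ hx0] at hj1
  rw [div_lt_iff₀ hx0] at hj2
  calc (1 / (2 * x₀)) ^ (θ / 2) * x ^ (θ / 2) = (x / (2 * x₀)) ^ (θ / 2) := by
        rw [← Real.mul_rpow (by positivity) (by linarith)]; congr 1; ring
    _ ≤ ((2 : ℝ) ^ j) ^ (θ / 2) := by
        have : 0 ≤ x := by linarith
        gcongr
        rw [div_le_iff₀ (by positivity)]
        rw [pow_succ] at hj2
        linarith
    _ = ((2 : ℝ) ^ (θ / 2)) ^ j := by
        rw [← Real.rpow_natCast, ← Real.rpow_natCast, ← Real.rpow_mul two_pos.le,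
          ← Real.rpow_mul two_pos.le, mul_comm]
    _ ≤ countFun p (2 ^ j * x₀) := hpow j
    _ ≤ countFun p x := by exact_mod_cast hp.countFun_mono (by positivity) hj1

/-- A fixed fraction of the urns with p_i ≥ 1/n satisfies p_i < 2/n. In these urns the mean load
stays between 1 and 2. -/
lemma exists_mul_countFun_le_sub (hθ : 0 < θ) (h : RegularCondition p θ) :
    ∃ c : ℝ, 0 < c ∧ ∀ᶠ n : ℕ in atTop,
      c * countFun p n ≤ countFun p n - countFun p ((n : ℝ) / 2) := by
  have hγ : (1 : ℝ) < 2 ^ (θ / 2) := Real.one_lt_rpow (by norm_num) (by linarith)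
  refine ⟨1 - (2 ^ (θ / 2))⁻¹, sub_pos.2 (inv_lt_one_of_one_lt₀ hγ), ?_⟩
  have ht : Tendsto (fun n : ℕ => (n : ℝ) / 2) atTop atTop :=
    tendsto_natCast_atTop_atTop.atTop_div_const two_pos
  filter_upwards [ht.eventually (h.eventually_le hθ)] with n hn
  rw [mul_div_cancel₀ (n : ℝ) (two_ne_zero)] at hn
  have := (le_inv_mul_iff₀ (by positivity)).2 hn
  linarith

lemma exists_le_choose_mul_pow (k : ℕ) : ∃ c : ℝ, 0 < c ∧ ∀ᶠ n : ℕ in atTop, ∀ q : ℝ,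
    1 / n ≤ q → c ≤ n.choose k * q ^ k := by
  refine ⟨(1 / 2) ^ k / k.factorial, by positivity, ?_⟩
  filter_upwards [eventually_ge_atTop (2 * k), eventually_gt_atTop 0] with n hn hn0 q hq
  have hn0' : (0 : ℝ) < n := by exact_mod_cast hn0
  have h1 : ((n + 1 - k : ℕ) : ℝ) ^ k ≤ k.factorial * n.choose k := by
    have := Nat.pow_sub_le_descFactorial n k
    rw [Nat.descFactorial_eq_factorial_mul_choose] at this
    exact_mod_cast this
  have h2 : (n : ℝ) / 2 ≤ ((n + 1 - k : ℕ) : ℝ) := by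
    have : n ≤ 2 * (n + 1 - k) := by omega
    have : (n : ℝ) ≤ 2 * ((n + 1 - k : ℕ) : ℝ) := by exact_mod_cast this
    linarith
  rw [div_le_iff₀ (by positivity)]
  calc (1 / 2 : ℝ) ^ k = ((n : ℝ) / 2) ^ k * (1 / n) ^ k := by
        rw [← mul_pow]; congr 1; field_simp
    _ ≤ ((n + 1 - k : ℕ) : ℝ) ^ k * q ^ k := by gcongr
    _ ≤ (k.factorial * n.choose k) * q ^ k := by
        have : 0 ≤ q := le_trans (by positivity) hq
        gcongr
    _ = _ := by ring

lemma sub_nonneg_binTail (hp : IsUrnProb p) (n k i : ℕ) :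
    0 ≤ binTail (p i) n k - binTail (p i) n (k + 1) :=
  sub_nonneg.2 (binTail_succ_le (hp.nonneg i) (hp.le_one i) n k)

lemma summable_sub_binTail (hp : IsUrnProb p) {k : ℕ} (hk : 1 ≤ k) (n : ℕ) :
    Summable fun i => binTail (p i) n k - binTail (p i) n (k + 1) :=
  (hp.summable_binTail hk n).sub (hp.summable_binTail (by omega) n)

lemma meanOcc_sub (hp : IsUrnProb p) {k : ℕ} (hk : 1 ≤ k) (n : ℕ) :
    meanOcc p k n - meanOcc p (k + 1) n =
      ∑' i, (binTail (p i) n k - binTail (p i) n (k + 1)) :=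
  ((hp.summable_binTail hk n).tsum_sub (hp.summable_binTail (by omega) n)).symm

/-- The expected number of urns with exactly `k` balls is at least of the order of the counting
function. -/
lemma exists_mul_countFun_le_meanOcc_sub (hp : IsUrnProb p) (hθ : 0 < θ)
    (h : RegularCondition p θ) {k : ℕ} (hk : 1 ≤ k) :
    ∃ c : ℝ, 0 < c ∧ ∀ᶠ n : ℕ in atTop,
      c * countFun p n ≤ meanOcc p k n - meanOcc p (k + 1) n := by
  obtain ⟨c, hc, h1⟩ := exists_mul_countFun_le_sub hθ h
  obtain ⟨d, hd, h2⟩ := exists_le_choose_mul_pow k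
  refine ⟨c * (Real.exp (-4) * d), by positivity, ?_⟩
  filter_upwards [h1, h2, eventually_ge_atTop 4] with n h1 h2 hn
  have hn0 : (0 : ℝ) < n := by exact_mod_cast (show 0 < n by omega)
  have hle : countFun p ((n : ℝ) / 2) ≤ countFun p n :=
    hp.countFun_mono (by positivity) (by linarith)
  -- The urns with 1/n ≤ p_i < 2/n; each holds exactly k balls with probability at least exp(-4) d.
  set s := Finset.Ioc (countFun p ((n : ℝ) / 2)) (countFun p n)
  have hs : (s.card : ℝ) = countFun p n - countFun p ((n : ℝ) / 2) := by
    rw [Nat.card_Ioc, Nat.cast_sub hle]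
  calc c * (Real.exp (-4) * d) * countFun p n = (c * countFun p n) * (Real.exp (-4) * d) := by ring
    _ ≤ s.card * (Real.exp (-4) * d) := by rw [hs]; gcongr
    _ = ∑ i ∈ s, Real.exp (-4) * d := by simp
    _ ≤ ∑ i ∈ s, (binTail (p i) n k - binTail (p i) n (k + 1)) := by
        refine Finset.sum_le_sum fun i hi => ?_
        rw [Finset.mem_Ioc] at hi
        have hi1 : 1 ≤ i := by omega
        have e1 : 1 / (n : ℝ) ≤ p i := (hp.le_countFun_iff hn0 hi1).1 hi.2
        have e2 : ¬ (1 / ((n : ℝ) / 2) ≤ p i) := by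
          rw [← hp.le_countFun_iff (by positivity) hi1]; omega
        have e3 : n * p i ≤ 2 := by
          rw [not_le, one_div_div, lt_div_iff₀ hn0] at e2
          linarith
        refine le_trans ?_ (binTail_le_exp_mul_sub (hp.nonneg i) hn e3 k)
        gcongr
        exact h2 _ e1
    _ ≤ _ := by
        rw [hp.meanOcc_sub hk]
        exact (hp.summable_sub_binTail hk n).sum_le_tsum _
          fun i _ => hp.sub_nonneg_binTail n k i

lemma exists_rpow_le_meanOcc (hp : IsUrnProb p) (hθ : 0 < θ)
    (h : RegularCondition p θ) {k : ℕ} (hk : 1 ≤ k) :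
    ∃ c : ℝ, 0 < c ∧ ∀ᶠ n : ℕ in atTop, c * (n : ℝ) ^ (θ / 2) ≤ meanOcc p k n := by
  obtain ⟨c, hc, h1⟩ := hp.exists_mul_countFun_le_meanOcc_sub hθ h hk
  obtain ⟨d, hd, h2⟩ := hp.exists_rpow_le_countFun hθ h
  refine ⟨c * d, by positivity, ?_⟩
  filter_upwards [h1, tendsto_natCast_atTop_atTop.eventually h2] with n h1 h2
  have := hp.meanOcc_nonneg (k + 1) n
  calc c * d * (n : ℝ) ^ (θ / 2) = c * (d * (n : ℝ) ^ (θ / 2)) := by ring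
    _ ≤ c * countFun p n := by gcongr
    _ ≤ _ := by linarith

/-- The number of urns with at least `k` balls and the number of urns with exactly `k` balls have
expectations of the same order. -/
lemma exists_meanOcc_le_mul_sub (hp : IsUrnProb p) (hθ : 0 < θ)
    (h : RegularCondition p θ) {k : ℕ} (hk : 1 ≤ k) :
    ∃ C : ℝ, 0 < C ∧ ∀ᶠ n : ℕ in atTop,
      meanOcc p k n ≤ C * (meanOcc p k n - meanOcc p (k + 1) n) := by
  obtain ⟨c, hc, h1⟩ := hp.exists_mul_countFun_le_meanOcc_sub hθ h hk
  refine ⟨Real.exp 4 + c⁻¹, by positivity, ?_⟩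
  filter_upwards [h1, eventually_ge_atTop 4] with n h1 hn
  have hn0 : (0 : ℝ) < n := by exact_mod_cast (show 0 < n by omega)
  set s := Finset.Ioc 0 (countFun p n)
  -- Urns with p_i ≥ 1/n are bounded by 1 each and contribute at most α(n) in all. For the others n
  -- p_i ≤ 2, and the tail is compared with its first term.
  have hind : ∀ i, binTail (p i) n k ≤
      Real.exp 4 * (binTail (p i) n k - binTail (p i) n (k + 1)) +
        (s : Set ℕ).indicator 1 i := by
    intro i
    by_cases hi : i ∈ s
    · rw [Set.indicator_of_mem (by exact_mod_cast hi)]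
      have := binTail_le_one (hp.nonneg i) (hp.le_one i) n k
      have := mul_nonneg (Real.exp_pos 4).le (hp.sub_nonneg_binTail n k i)
      simp only [Pi.one_apply]
      linarith
    · rw [Set.indicator_of_notMem (by exact_mod_cast hi), add_zero]
      have e3 : n * p i ≤ 2 := by
        rcases Nat.eq_zero_or_pos i with rfl | hi1
        · rw [hp.zero]; simp
        · have : ¬ (1 / (n : ℝ) ≤ p i) := by
            rw [← hp.le_countFun_iff hn0 hi1]
            simpa [s, hi1] using hi
          rw [not_le, lt_div_iff₀ hn0] at this
          linarith
      have e4 := binTail_le_exp_mul_sub (hp.nonneg i) hn e3 k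
      rw [Real.exp_neg, inv_mul_le_iff₀ (Real.exp_pos 4)] at e4
      exact (binTail_le_choose (hp.nonneg i) (hp.le_one i) n k).trans e4
  have hsum : HasSum ((s : Set ℕ).indicator (1 : ℕ → ℝ)) (countFun p n) := by
    have : HasSum ((s : Set ℕ).indicator (1 : ℕ → ℝ))
        (∑ i ∈ s, (s : Set ℕ).indicator (1 : ℕ → ℝ) i) :=
      hasSum_sum_of_ne_finset_zero
        fun i hi => Set.indicator_of_notMem (by exact_mod_cast hi) _
    convert this using 1
    rw [Finset.sum_congr rfl (g := fun _ => (1 : ℝ)) fun i hi => by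
      rw [Set.indicator_of_mem (by exact_mod_cast hi)]; rfl]
    simp [s]
  have e5 := (hp.summable_binTail hk n).tsum_le_tsum hind
    (((hp.summable_sub_binTail hk n).mul_left _).add hsum.summable)
  rw [((hp.summable_sub_binTail hk n).mul_left _).tsum_add hsum.summable, tsum_mul_left,
    ← hp.meanOcc_sub hk, hsum.tsum_eq] at e5
  refine e5.trans ?_
  rw [← le_inv_mul_iff₀ hc] at h1
  linarith

end IsUrnProb

end UrnScheme

/-! ### Loads of urns: their law and negative correlation -/

namespace UrnScheme

/-- The number of balls with indices in `T` that hit urn `i`. -/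
def load (x : ℕ+ → ℕ) (T : Finset ℕ+) (i : ℕ) : ℕ := (T.filter fun m => x m = i).card

lemma load_insert (x : ℕ+ → ℕ) {T : Finset ℕ+} {m : ℕ+} (hm : m ∉ T) (i : ℕ) :
    load x (insert m T) i = load x T i + if x m = i then 1 else 0 := by
  unfold load
  rw [Finset.filter_insert]
  split_ifs
  · rw [Finset.card_insert_of_notMem (by simp [hm])]
  · rfl

lemma load_mono (x : ℕ+ → ℕ) {S T : Finset ℕ+} (h : S ⊆ T) (i : ℕ) : load x S i ≤ load x T i :=
  Finset.card_le_card (Finset.filter_subset_filter _ h)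

lemma load_congr {x y : ℕ+ → ℕ} {T : Finset ℕ+} (h : ∀ m ∈ T, x m = y m) (i : ℕ) :
    load x T i = load y T i := by
  unfold load
  rw [Finset.filter_congr fun m hm => by rw [h m hm]]

variable {Ω : Type*} [MeasurableSpace Ω] {μ : Measure Ω} {X : ℕ+ → Ω → ℕ}

namespace IsUrnScheme

lemma measurableSet_mem (hX : IsUrnScheme μ X) (m : ℕ+) (B : Set ℕ) :
    MeasurableSet {ω | X m ω ∈ B} := hX.measurable m (MeasurableSet.of_discrete (s := B))

lemma measurable_load (hX : IsUrnScheme μ X) (T : Finset ℕ+) (i : ℕ) :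
    Measurable fun ω => load (fun m => X m ω) T i := by
  induction T using Finset.induction_on with
  | empty => simp [load]
  | insert m T hm ih =>
    simp only [load_insert _ hm]
    exact ih.add (Measurable.ite (hX.measurableSet_mem m {i}) measurable_const measurable_const)

lemma measurableSet_le_load (hX : IsUrnScheme μ X) (T : Finset ℕ+) (i k : ℕ) :
    MeasurableSet {ω | k ≤ load (fun m => X m ω) T i} :=
  measurableSet_le measurable_const (hX.measurable_load T i)

lemma measureReal_eq (hX : IsUrnScheme μ X) (m : ℕ+) (i : ℕ) :
    μ.real {ω | X m ω = i} = urnProb μ X i := by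
  have := (hX.ident m).measure_mem_eq (MeasurableSet.of_discrete (s := {i}))
  exact congrArg ENNReal.toReal this

/-- A ball is independent of every event that depends on finitely many other balls only. -/
lemma measureReal_inter (hX : IsUrnScheme μ X) {T : Finset ℕ+} {m : ℕ+} (hm : m ∉ T) (B : Set ℕ)
    (E : Set (ℕ+ → ℕ)) (hE : ∀ x y : ℕ+ → ℕ, (∀ s ∈ T, x s = y s) → x ∈ E → y ∈ E) :
    μ.real ({ω | X m ω ∈ B} ∩ {ω | (fun s => X s ω) ∈ E}) =
      μ.real {ω | X m ω ∈ B} * μ.real {ω | (fun s => X s ω) ∈ E} := by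
  have hind := hX.indep.indepFun_finset {m} T (by simpa using hm) hX.measurable
  let B' : Set (({m} : Finset ℕ+) → ℕ) := {z | z ⟨m, by simp⟩ ∈ B}
  -- The projection of E to the coordinates in T; by `hE` nothing is lost in projecting.
  let E' : Set (T → ℕ) := {z | ∃ x ∈ E, ∀ s : T, x s = z s}
  have hE' : {ω | (fun s => X s ω) ∈ E} = (fun ω (s : T) => X s ω) ⁻¹' E' := by
    ext ω
    constructor
    · intro h
      exact ⟨_, h, fun s => rfl⟩
    · rintro ⟨x, hx, h⟩
      exact hE x _ (fun s hs => h ⟨s, hs⟩) hx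
  have := hind.measure_inter_preimage_eq_mul B' E' MeasurableSet.of_discrete
    MeasurableSet.of_discrete
  rw [hE']
  have h2 := congrArg ENNReal.toReal this
  rw [ENNReal.toReal_mul] at h2
  exact h2

variable [IsProbabilityMeasure μ]

lemma isUrnProb (hX : IsUrnScheme μ X) : IsUrnProb (urnProb μ X) where
  zero := by
    have : {ω | X 1 ω = 0} = ∅ := by
      ext ω
      have := hX.pos 1 ω
      simp only [Set.mem_ofPred_eq, Set.mem_empty_iff_false, iff_false]
      omega
    simp [urnProb, this]
  pos := hX.prob_pos
  le_one := fun i => measureReal_le_one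
  anti := hX.prob_anti
  summable := by
    refine summable_of_sum_le (c := 1) (fun i => measureReal_nonneg) fun u => ?_
    unfold urnProb
    rw [← measureReal_biUnion_finset]
    · exact measureReal_le_one
    · intro i _ j _ hij
      refine Set.disjoint_left.2 fun ω h1 h2 => hij ?_
      exact h1.symm.trans h2
    · exact fun i _ => hX.measurableSet_mem 1 {i}

lemma measureReal_le_load (hX : IsUrnScheme μ X) (T : Finset ℕ+) (i k : ℕ) :
    μ.real {ω | k ≤ load (fun m => X m ω) T i} = binTail (urnProb μ X i) T.card k := by
  induction T using Finset.induction_on generalizing k with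
  | empty => cases k <;> simp [load, binTail]
  | insert m T hm ih =>
    have hsplit : {ω | k ≤ load (fun m => X m ω) (insert m T) i} =
        ({ω | X m ω ∈ ({i} : Set ℕ)} ∩
          {ω | (fun s => X s ω) ∈ {x : ℕ+ → ℕ | k - 1 ≤ load x T i}}) ∪
        ({ω | X m ω ∈ ({i}ᶜ : Set ℕ)} ∩
          {ω | (fun s => X s ω) ∈ {x : ℕ+ → ℕ | k ≤ load x T i}}) := by
      ext ω
      simp only [load_insert _ hm, Set.mem_ofPred_eq, Set.mem_union, Set.mem_inter_iff,
        Set.mem_singleton_iff, Set.mem_compl_iff]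
      by_cases h : X m ω = i <;> simp [h]
    have hE (a : ℕ) (x y : ℕ+ → ℕ) (h : ∀ s ∈ T, x s = y s) :
        x ∈ {x : ℕ+ → ℕ | a ≤ load x T i} → y ∈ {x : ℕ+ → ℕ | a ≤ load x T i} := by
      simp only [Set.mem_ofPred_eq, load_congr h, imp_self]
    rw [hsplit, measureReal_union, hX.measureReal_inter hm _ _ (hE _),
      hX.measureReal_inter hm _ _ (hE _)]
    · have h1 : μ.real {ω | X m ω ∈ ({i} : Set ℕ)} = urnProb μ X i := hX.measureReal_eq m i
      have h2 : μ.real {ω | X m ω ∈ ({i}ᶜ : Set ℕ)} = 1 - urnProb μ X i := by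
        rw [← h1, ← probReal_compl_eq_one_sub (hX.measurableSet_mem m {i})]; rfl
      rw [h1, h2, Finset.card_insert_of_notMem hm, binTail_succ]
      congr 2
      · exact ih _
      · exact ih _
    · refine Set.disjoint_left.2 fun ω h1 h2 => ?_
      exact h2.1 h1.1
    · exact (hX.measurableSet_mem m _).inter (hX.measurableSet_le_load T i k)

/-- The loads of different urns are negatively correlated. -/
lemma measureReal_le_load_inter_le (hX : IsUrnScheme μ X) (T : Finset ℕ+) {i j : ℕ} (hij : i ≠ j)
    (a b : ℕ) :
    μ.real ({ω | a ≤ load (fun m => X m ω) T i} ∩ {ω | b ≤ load (fun m => X m ω) T j}) ≤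
      binTail (urnProb μ X i) T.card a * binTail (urnProb μ X j) T.card b := by
  have hp := hX.isUrnProb
  induction T using Finset.induction_on generalizing a b with
  | empty => cases a <;> cases b <;> simp [load, binTail]
  | insert m T hm ih =>
    let G (a b : ℕ) : Set (ℕ+ → ℕ) := {x | a ≤ load x T i ∧ b ≤ load x T j}
    have hG (a b : ℕ) (x y : ℕ+ → ℕ) (h : ∀ s ∈ T, x s = y s) : x ∈ G a b → y ∈ G a b := by
      simp only [G, Set.mem_ofPred_eq, load_congr h, imp_self]
    -- Condition on the new ball: it hits i, j or neither.
    have hsplit : {ω | a ≤ load (fun m => X m ω) (insert m T) i} ∩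
          {ω | b ≤ load (fun m => X m ω) (insert m T) j} ⊆
        (({ω | X m ω ∈ ({i} : Set ℕ)} ∩ {ω | (fun s => X s ω) ∈ G (a - 1) b}) ∪
        ({ω | X m ω ∈ ({j} : Set ℕ)} ∩ {ω | (fun s => X s ω) ∈ G a (b - 1)})) ∪
        ({ω | X m ω ∈ ({i, j}ᶜ : Set ℕ)} ∩ {ω | (fun s => X s ω) ∈ G a b}) := by
      intro ω
      simp only [load_insert _ hm, Set.mem_ofPred_eq, Set.mem_union, Set.mem_inter_iff,
        Set.mem_singleton_iff, Set.mem_compl_iff, Set.mem_insert_iff, G]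
      by_cases h : X m ω = i
      · simp [h, hij]
      · by_cases h' : X m ω = j <;> simp [h, h', hij.symm]
    have h1 : μ.real {ω | X m ω ∈ ({i} : Set ℕ)} = urnProb μ X i := hX.measureReal_eq m i
    have h2 : μ.real {ω | X m ω ∈ ({j} : Set ℕ)} = urnProb μ X j := hX.measureReal_eq m j
    have h12 : μ.real {ω | X m ω ∈ ({i, j} : Set ℕ)} = urnProb μ X i + urnProb μ X j := by
      rw [← h1, ← h2, ← measureReal_union _ (hX.measurableSet_mem m {j})]
      · rfl
      · exact Set.disjoint_left.2 fun ω h h' => hij (h.symm.trans h')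
    have h3 : μ.real {ω | X m ω ∈ ({i, j}ᶜ : Set ℕ)} =
        1 - (urnProb μ X i + urnProb μ X j) := by
      rw [← h12, ← probReal_compl_eq_one_sub (hX.measurableSet_mem m {i, j})]; rfl
    have hle : urnProb μ X i + urnProb μ X j ≤ 1 := h12 ▸ measureReal_le_one
    have hle' := sub_nonneg.2 hle
    have i1 : μ.real {ω | (fun s => X s ω) ∈ G (a - 1) b} ≤ _ := ih (a - 1) b
    have i2 : μ.real {ω | (fun s => X s ω) ∈ G a (b - 1)} ≤ _ := ih a (b - 1)
    have i3 : μ.real {ω | (fun s => X s ω) ∈ G a b} ≤ _ := ih a b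
    refine (measureReal_mono hsplit).trans ((measureReal_union_le _ _).trans
      ((add_le_add_left (measureReal_union_le _ _) _).trans ?_))
    rw [hX.measureReal_inter hm _ _ (hG _ _), hX.measureReal_inter hm _ _ (hG _ _),
      hX.measureReal_inter hm _ _ (hG _ _), h1, h2, h3, Finset.card_insert_of_notMem hm,
      binTail_succ, binTail_succ]
    have j1 := mul_le_mul_of_nonneg_left i1 (hp.nonneg i)
    have j2 := mul_le_mul_of_nonneg_left i2 (hp.nonneg j)
    have j3 := mul_le_mul_of_nonneg_left i3 hle'
    have k1 := sub_nonneg.2 (binTail_le_pred (hp.nonneg i) (hp.le_one i) T.card a)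
    have k2 := sub_nonneg.2 (binTail_le_pred (hp.nonneg j) (hp.le_one j) T.card b)
    -- The product of the two one-urn recursions exceeds the joint recursion by exactly this term:
    -- the product allows one ball to hit both urns.
    have k3 := mul_nonneg (mul_nonneg (hp.nonneg i) (hp.nonneg j)) (mul_nonneg k1 k2)
    linear_combination j1 + j2 + j3 + k3

end IsUrnScheme

end UrnScheme

/-! ### Moments of occupancy counts and convergence along sparse sequences -/

namespace UrnScheme

/-- The number of urns that contain at least `k` balls with indices in `T`. -/
noncomputable def occ (x : ℕ+ → ℕ) (T : Finset ℕ+) (k : ℕ) : ℕ := {i | k ≤ load x T i}.ncard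

lemma setOf_le_load_subset (x : ℕ+ → ℕ) (T : Finset ℕ+) {k : ℕ} (hk : 1 ≤ k) :
    {i | k ≤ load x T i} ⊆ (T.image x : Set ℕ) := by
  intro i hi
  have : 0 < load x T i := lt_of_lt_of_le hk hi
  obtain ⟨m, hm⟩ := Finset.card_pos.1 this
  rw [Finset.mem_filter] at hm
  exact Finset.mem_coe.2 (Finset.mem_image.2 ⟨m, hm⟩)

lemma finite_le_load (x : ℕ+ → ℕ) (T : Finset ℕ+) {k : ℕ} (hk : 1 ≤ k) :
    {i | k ≤ load x T i}.Finite :=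
  (Finset.finite_toSet _).subset (setOf_le_load_subset x T hk)

lemma occ_le_card (x : ℕ+ → ℕ) (T : Finset ℕ+) {k : ℕ} (hk : 1 ≤ k) : occ x T k ≤ T.card :=
  (Set.ncard_le_ncard (setOf_le_load_subset x T hk) (Finset.finite_toSet _)).trans
    (by rw [Set.ncard_coe_finset]; exact Finset.card_image_le)

lemma occ_mono (x : ℕ+ → ℕ) {S T : Finset ℕ+} (h : S ⊆ T) {k : ℕ} (hk : 1 ≤ k) :
    occ x S k ≤ occ x T k :=
  Set.ncard_le_ncard (fun i hi => le_trans (α := ℕ) hi (load_mono x h i)) (finite_le_load x T hk)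

lemma occ_eq_tsum (x : ℕ+ → ℕ) (T : Finset ℕ+) {k : ℕ} (hk : 1 ≤ k) :
    (occ x T k : ENNReal) = ∑' i, {i | k ≤ load x T i}.indicator 1 i := by
  have h1 := ENNReal.tsum_set_one {i | k ≤ load x T i}
  rw [← (finite_le_load x T hk).cast_ncard_eq] at h1
  have h2 := tsum_subtype {i | k ≤ load x T i} (fun _ => (1 : ENNReal))
  rw [h1] at h2
  exact h2

variable {Ω : Type*} [MeasurableSpace Ω] {μ : Measure Ω} {X : ℕ+ → Ω → ℕ}

namespace IsUrnScheme

lemma measurable_occ (hX : IsUrnScheme μ X) (T : Finset ℕ+) {k : ℕ} (hk : 1 ≤ k) :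
    Measurable fun ω => (occ (fun m => X m ω) T k : ENNReal) := by
  simp only [occ_eq_tsum _ T hk]
  refine Measurable.tsum fun i => ?_
  exact (measurable_one : Measurable (1 : Ω → ENNReal)).indicator (hX.measurableSet_le_load T i k)

lemma measurable_occ_real (hX : IsUrnScheme μ X) (T : Finset ℕ+) {k : ℕ} (hk : 1 ≤ k) :
    Measurable fun ω => (occ (fun m => X m ω) T k : ℝ) := by
  simpa using (hX.measurable_occ T hk).ennreal_toReal

variable [IsProbabilityMeasure μ]

lemma measure_le_load (hX : IsUrnScheme μ X) (T : Finset ℕ+) (i k : ℕ) :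
    μ {ω | k ≤ load (fun m => X m ω) T i} =
      ENNReal.ofReal (binTail (urnProb μ X i) T.card k) := by
  rw [← hX.measureReal_le_load, ofReal_measureReal]

lemma tsum_ofReal_binTail (hX : IsUrnScheme μ X) (n : ℕ) {k : ℕ} (hk : 1 ≤ k) :
    ∑' i, ENNReal.ofReal (binTail (urnProb μ X i) n k) =
      ENNReal.ofReal (meanOcc (urnProb μ X) k n) := by
  have hp := hX.isUrnProb
  exact (ENNReal.ofReal_tsum_of_nonneg (fun i => binTail_nonneg (hp.nonneg i) (hp.le_one i) n k)
    (hp.summable_binTail hk n)).symm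

lemma lintegral_occ (hX : IsUrnScheme μ X) (T : Finset ℕ+) {k : ℕ} (hk : 1 ≤ k) :
    ∫⁻ ω, (occ (fun m => X m ω) T k : ENNReal) ∂μ =
      ENNReal.ofReal (meanOcc (urnProb μ X) k T.card) := by
  have e (ω : Ω) : (occ (fun m => X m ω) T k : ENNReal) =
      ∑' i, {ω | k ≤ load (fun m => X m ω) T i}.indicator 1 ω := occ_eq_tsum _ T hk
  simp only [e]
  rw [lintegral_tsum fun i => ((measurable_one : Measurable (1 : Ω → ENNReal)).indicator
    (hX.measurableSet_le_load T i k)).aemeasurable, ← hX.tsum_ofReal_binTail _ hk]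
  refine tsum_congr fun i => ?_
  rw [← hX.measure_le_load, ← lintegral_indicator_one (hX.measurableSet_le_load T i k)]

/-- Expand the square into pairs of urns. Negative correlation bounds the off-diagonal pairs by the
squared mean, and the diagonal adds one mean; hence variance ≤ mean. -/
lemma lintegral_occ_sq_le (hX : IsUrnScheme μ X) (T : Finset ℕ+) {k : ℕ} (hk : 1 ≤ k) :
    ∫⁻ ω, (occ (fun m => X m ω) T k : ENNReal) ^ 2 ∂μ ≤
      ENNReal.ofReal (meanOcc (urnProb μ X) k T.card) ^ 2 +
        ENNReal.ofReal (meanOcc (urnProb μ X) k T.card) := by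
  have hp := hX.isUrnProb
  let A (i : ℕ) : Set Ω := {ω | k ≤ load (fun m => X m ω) T i}
  have hA (i : ℕ) : MeasurableSet (A i) := hX.measurableSet_le_load T i k
  let a (i : ℕ) : ENNReal := ENNReal.ofReal (binTail (urnProb μ X i) T.card k)
  have hsq (ω : Ω) : (occ (fun m => X m ω) T k : ENNReal) ^ 2 =
      ∑' i, ∑' j, (A i ∩ A j).indicator 1 ω := by
    rw [occ_eq_tsum _ T hk, sq, ← ENNReal.tsum_mul_right]
    refine tsum_congr fun i => ?_
    rw [← ENNReal.tsum_mul_left]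
    refine tsum_congr fun j => ?_
    rw [Set.inter_indicator_one]
    rfl
  have hmeas (i j : ℕ) : Measurable ((A i ∩ A j).indicator (1 : Ω → ENNReal)) :=
    measurable_one.indicator ((hA i).inter (hA j))
  have hle (i j : ℕ) : μ (A i ∩ A j) ≤ a i * a j + if j = i then a i else 0 := by
    split_ifs with h
    · subst h
      rw [Set.inter_self]
      exact (hX.measure_le_load T j k).le.trans le_add_self
    · rw [add_zero, ← ofReal_measureReal,
        ← ENNReal.ofReal_mul (binTail_nonneg (hp.nonneg i) (hp.le_one i) _ _)]
      exact ENNReal.ofReal_le_ofReal (hX.measureReal_le_load_inter_le T (Ne.symm h) k k)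
  calc ∫⁻ ω, (occ (fun m => X m ω) T k : ENNReal) ^ 2 ∂μ
      = ∑' i, ∑' j, μ (A i ∩ A j) := by
        simp only [hsq]
        rw [lintegral_tsum fun i => (Measurable.tsum (hmeas i)).aemeasurable]
        refine tsum_congr fun i => ?_
        rw [lintegral_tsum fun j => (hmeas i j).aemeasurable]
        exact tsum_congr fun j => lintegral_indicator_one ((hA i).inter (hA j))
    _ ≤ ∑' i, ∑' j, (a i * a j + if j = i then a i else 0) :=
        ENNReal.tsum_le_tsum fun i => ENNReal.tsum_le_tsum fun j => hle i j
    _ = _ := by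
        simp only [ENNReal.tsum_add, ENNReal.tsum_mul_left, ENNReal.tsum_mul_right, tsum_ite_eq]
        rw [show ∑' i, a i = _ from hX.tsum_ofReal_binTail T.card hk, sq]

lemma integrable_occ (hX : IsUrnScheme μ X) (T : Finset ℕ+) {k : ℕ} (hk : 1 ≤ k) :
    Integrable (fun ω => (occ (fun m => X m ω) T k : ℝ)) μ := by
  refine Integrable.of_bound (hX.measurable_occ_real T hk).aestronglyMeasurable (T.card : ℝ)
    (ae_of_all _ fun ω => ?_)
  rw [Real.norm_natCast]
  exact_mod_cast occ_le_card _ T hk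

lemma integrable_occ_sq (hX : IsUrnScheme μ X) (T : Finset ℕ+) {k : ℕ} (hk : 1 ≤ k) :
    Integrable (fun ω => (occ (fun m => X m ω) T k : ℝ) ^ 2) μ := by
  refine Integrable.of_bound ((hX.measurable_occ_real T hk).pow_const 2).aestronglyMeasurable
    ((T.card : ℝ) ^ 2) (ae_of_all _ fun ω => ?_)
  rw [norm_pow, Real.norm_natCast]
  gcongr
  exact_mod_cast occ_le_card _ T hk

lemma integral_occ (hX : IsUrnScheme μ X) (T : Finset ℕ+) {k : ℕ} (hk : 1 ≤ k) :
    ∫ ω, (occ (fun m => X m ω) T k : ℝ) ∂μ = meanOcc (urnProb μ X) k T.card := by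
  rw [integral_eq_lintegral_of_nonneg_ae (ae_of_all _ fun ω => Nat.cast_nonneg _)
    (hX.measurable_occ_real T hk).aestronglyMeasurable]
  simp only [ENNReal.ofReal_natCast]
  rw [hX.lintegral_occ T hk, ENNReal.toReal_ofReal (hX.isUrnProb.meanOcc_nonneg _ _)]

lemma integral_occ_sq_le (hX : IsUrnScheme μ X) (T : Finset ℕ+) {k : ℕ} (hk : 1 ≤ k) :
    ∫ ω, (occ (fun m => X m ω) T k : ℝ) ^ 2 ∂μ ≤
      meanOcc (urnProb μ X) k T.card ^ 2 + meanOcc (urnProb μ X) k T.card := by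
  have h0 := hX.isUrnProb.meanOcc_nonneg k T.card
  rw [integral_eq_lintegral_of_nonneg_ae (ae_of_all _ fun ω => by positivity)
    ((hX.measurable_occ_real T hk).pow_const 2).aestronglyMeasurable]
  refine ENNReal.toReal_le_of_le_ofReal (by positivity) ?_
  rw [ENNReal.ofReal_add (by positivity) h0, ENNReal.ofReal_pow h0]
  refine le_trans (le_of_eq ?_) (hX.lintegral_occ_sq_le T hk)
  refine lintegral_congr fun ω => ?_
  rw [ENNReal.ofReal_pow (Nat.cast_nonneg _), ENNReal.ofReal_natCast]

lemma lintegral_sq_occ_div_sub_one_le (hX : IsUrnScheme μ X) (T : Finset ℕ+) {k : ℕ} (hk : 1 ≤ k)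
    (h0 : 0 < meanOcc (urnProb μ X) k T.card) :
    ∫⁻ ω, ENNReal.ofReal
        ((occ (fun m => X m ω) T k / meanOcc (urnProb μ X) k T.card - 1) ^ 2) ∂μ ≤
      ENNReal.ofReal (1 / meanOcc (urnProb μ X) k T.card) := by
  have h1 := hX.integral_occ T hk
  have h2 := hX.integral_occ_sq_le T hk
  have i1 := hX.integrable_occ T hk
  have i2 := hX.integrable_occ_sq T hk
  set f := meanOcc (urnProb μ X) k T.card
  have e (ω : Ω) : ((occ (fun m => X m ω) T k : ℝ) / f - 1) ^ 2 =
      ((f ^ 2)⁻¹ * (occ (fun m => X m ω) T k : ℝ) ^ 2 -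
        (2 / f) * (occ (fun m => X m ω) T k : ℝ)) + 1 := by
    field_simp; ring
  have i3 : Integrable (fun ω => ((occ (fun m => X m ω) T k : ℝ) / f - 1) ^ 2) μ := by
    simp only [e]
    exact ((i2.const_mul _).sub (i1.const_mul _)).add (integrable_const _)
  rw [← ofReal_integral_eq_lintegral_ofReal i3 (ae_of_all _ fun ω => sq_nonneg _)]
  refine ENNReal.ofReal_le_ofReal ?_
  simp only [e]
  rw [integral_add (f := fun ω => (f ^ 2)⁻¹ * (occ (fun m => X m ω) T k : ℝ) ^ 2 -
      2 / f * (occ (fun m => X m ω) T k : ℝ)) ((i2.const_mul _).sub (i1.const_mul _))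
      (integrable_const _),
    integral_sub (i2.const_mul _) (i1.const_mul _), integral_const_mul, integral_const_mul, h1]
  simp only [integral_const, probReal_univ, smul_eq_mul, mul_one]
  have h3 := mul_le_mul_of_nonneg_left h2 (show 0 ≤ (f ^ 2)⁻¹ by positivity)
  have h4 : (f ^ 2)⁻¹ * (f ^ 2 + f) = 1 + 1 / f := by field_simp
  have h5 : 2 / f * f = 2 := by field_simp
  linarith

/-- The law of large numbers along sequences of index sets whose expectations grow fast enough. -/
lemma ae_tendsto_occ_div (hX : IsUrnScheme μ X) {k : ℕ} (hk : 1 ≤ k) (T : ℕ → Finset ℕ+) {c : ℝ}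
    (hc : 0 < c) (hT : ∀ᶠ j : ℕ in atTop, c * (j : ℝ) ^ 2 ≤ meanOcc (urnProb μ X) k (T j).card) :
    ∀ᵐ ω ∂μ, Tendsto (fun j => (occ (fun m => X m ω) (T j) k : ℝ) /
      meanOcc (urnProb μ X) k (T j).card) atTop (𝓝 1) := by
  obtain ⟨J, hJ⟩ := eventually_atTop.1 (hT.and (eventually_ge_atTop 1))
  let Y (j : ℕ) (ω : Ω) : ℝ := (occ (fun m => X m ω) (T j) k : ℝ) /
    meanOcc (urnProb μ X) k (T j).card - 1
  have hmeas (j : ℕ) : Measurable fun ω => ENNReal.ofReal (Y j ω ^ 2) :=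
    ((((hX.measurable_occ_real (T j) hk).div_const _).sub_const 1).pow_const 2).ennreal_ofReal
  have hs : Summable fun j : ℕ => 1 / (c * ((j + J : ℕ) : ℝ) ^ 2) := by
    have h1 := (Real.summable_one_div_nat_pow (p := 2)).2 (by norm_num)
    have h2 := ((summable_nat_add_iff J).2 h1).mul_left c⁻¹
    refine h2.congr fun j => ?_
    rw [one_div, one_div, mul_inv]
  -- The series of squared errors has finite mean, so it converges almost surely and its terms tend
  -- to 0. The shift by J discards the indices where the growth bound may fail.
  have hfin : ∫⁻ ω, ∑' j, ENNReal.ofReal (Y (j + J) ω ^ 2) ∂μ ≠ ⊤ := by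
    rw [lintegral_tsum fun j => (hmeas _).aemeasurable]
    refine ne_top_of_le_ne_top hs.tsum_ofReal_ne_top (ENNReal.tsum_le_tsum fun j => ?_)
    obtain ⟨h1, h2⟩ := hJ (j + J) (by omega)
    have h3 : (0 : ℝ) < ((j + J : ℕ) : ℝ) := by exact_mod_cast h2
    have h4 : 0 < c * ((j + J : ℕ) : ℝ) ^ 2 := by positivity
    exact (hX.lintegral_sq_occ_div_sub_one_le _ hk (h4.trans_le h1)).trans
      (ENNReal.ofReal_le_ofReal (one_div_le_one_div_of_le h4 h1))
  filter_upwards [ae_lt_top (Measurable.tsum fun j => hmeas (j + J)) hfin] with ω hω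
  have h1 := ENNReal.tendsto_atTop_zero_of_tsum_ne_top hω.ne
  have h2 := (ENNReal.tendsto_toReal ENNReal.zero_ne_top).comp h1
  have h3 : Tendsto (fun j => Y (j + J) ω) atTop (𝓝 0) := by
    have h4 := h2.sqrt
    simp only [Function.comp_def, ENNReal.toReal_ofReal (sq_nonneg _), Real.sqrt_sq_eq_abs,
      ENNReal.toReal_zero, Real.sqrt_zero] at h4
    exact (tendsto_zero_iff_abs_tendsto_zero _).2 h4
  have h4 := ((tendsto_add_atTop_iff_nat (f := fun j => Y j ω) J).1 h3).add_const 1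
  simpa [Y] using h4

end IsUrnScheme

end UrnScheme

/-! ### Counting the indices in dilated sets -/

namespace UrnScheme

lemma card_le_of_forall_mem_Icc {s : Finset ℕ+} {u v : ℝ} (hu : 0 ≤ u) (huv : u ≤ v)
    (h : ∀ m ∈ s, u ≤ (m : ℝ) ∧ (m : ℝ) ≤ v) : (s.card : ℝ) ≤ v - u + 1 := by
  have h1 : s.card ≤ (Finset.Icc ⌈u⌉₊ ⌊v⌋₊).card := by
    refine Finset.card_le_card_of_injOn (fun m => (m : ℕ)) (fun m hm => ?_)
      (PNat.coe_injective.injOn)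
    obtain ⟨h1, h2⟩ := h m hm
    exact Finset.mem_coe.2 (Finset.mem_Icc.2 ⟨Nat.ceil_le.2 h1, Nat.le_floor h2⟩)
  rw [Nat.card_Icc] at h1
  have h2 := Nat.floor_le (hu.trans huv)
  have h3 := Nat.le_ceil u
  rcases le_total ⌈u⌉₊ (⌊v⌋₊ + 1) with h4 | h4
  · have h5 : (s.card : ℝ) ≤ ((⌊v⌋₊ + 1 - ⌈u⌉₊ : ℕ) : ℝ) := by exact_mod_cast h1
    rw [Nat.cast_sub h4] at h5
    push_cast at h5
    linarith
  · rw [Nat.sub_eq_zero_of_le h4] at h1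
    have h5 : (s.card : ℝ) ≤ 0 := by exact_mod_cast h1
    linarith

lemma le_card_of_forall_mem_Ioo {s : Finset ℕ+} {u v : ℝ} (hu : 0 ≤ u)
    (h : ∀ m : ℕ+, u < (m : ℝ) → (m : ℝ) < v → m ∈ s) : v - u - 1 ≤ s.card := by
  have h1 : (Finset.Ioo ⌊u⌋₊ ⌈v⌉₊).card ≤ s.card := by
    have hpos : ∀ t ∈ Finset.Ioo ⌊u⌋₊ ⌈v⌉₊, 0 < t := fun t ht => by
      have := (Finset.mem_Ioo.1 ht).1
      omega
    refine Finset.card_le_card_of_injOn Nat.toPNat' (fun t ht => ?_) fun t ht t' ht' htt => ?_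
    · have hc : ((Nat.toPNat' t : ℕ+) : ℕ) = t := by
        simp [hpos t ht]
      have ht2 := Finset.mem_Ioo.1 ht
      refine h _ ?_ ?_
      · rw [hc]; exact Nat.lt_of_floor_lt ht2.1
      · rw [hc]; exact Nat.lt_ceil.1 ht2.2
    · have h1 := congrArg (fun x : ℕ+ => (x : ℕ)) htt
      simpa [hpos t ht, hpos t' ht'] using h1
  rw [Nat.card_Ioo] at h1
  have h2 := Nat.floor_le hu
  have h3 := Nat.le_ceil v
  have h4 : (⌈v⌉₊ : ℝ) ≤ s.card + ⌊u⌋₊ + 1 := by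
    have : ⌈v⌉₊ ≤ s.card + ⌊u⌋₊ + 1 := by omega
    exact_mod_cast this
  linarith

open Classical in
/-- The indices of the balls in the dilation `nA`, for `A ⊆ [0, 1]`. -/
noncomputable def idx (A : Set ℝ) (n : ℕ) : Finset ℕ+ :=
  -- The range reaches n + 1 so that it is defined for n = 0; the filter removes the excess index
  -- because A ⊆ [0, 1].
  (Finset.Icc 1 n.succPNat).filter fun m => (m : ℝ) ∈ dilate n A

lemma mem_idx {A : Set ℝ} (hA : A ⊆ Set.Icc 0 1) {n : ℕ} {m : ℕ+} :
    m ∈ idx A n ↔ (m : ℝ) ∈ dilate n A := by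
  classical
  rw [idx, Finset.mem_filter, Finset.mem_Icc, and_iff_right_iff_imp]
  rintro ⟨a, ha, h⟩
  refine ⟨one_le, ?_⟩
  have h1 : (m : ℝ) ≤ n := by
    rw [← h]
    exact mul_le_of_le_one_right (Nat.cast_nonneg n) (hA ha).2
  have h2 : (m : ℕ) ≤ n := by exact_mod_cast h1
  rw [← PNat.coe_le_coe, Nat.succPNat_coe]
  omega

lemma mem_idx_iff_div_mem {A : Set ℝ} (hA : A ⊆ Set.Icc 0 1) {n : ℕ} (hn : 0 < n) {m : ℕ+} :
    m ∈ idx A n ↔ (m : ℝ) / n ∈ A := by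
  have hn' : (n : ℝ) ≠ 0 := by exact_mod_cast hn.ne'
  rw [mem_idx hA]
  constructor
  · rintro ⟨a, ha, h⟩
    rw [← h]
    simpa [hn'] using ha
  · intro h
    exact ⟨_, h, by field_simp⟩

lemma IsFiniteUnionOfIntervals.subset_Icc {A : Set ℝ} (hA : IsFiniteUnionOfIntervals A) :
    A ⊆ Set.Icc 0 1 := by
  obtain ⟨F, -, hF, rfl⟩ := hA
  exact Set.sUnion_subset fun I hI => (hF I hI).2

lemma urnsAtLeast_dilate {A : Set ℝ} (hA : A ⊆ Set.Icc 0 1) {x : ℕ+ → ℕ} (hx : ∀ m, 1 ≤ x m)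
    {k : ℕ} (hk : 1 ≤ k) (n : ℕ) : urnsAtLeast x (dilate n A) k = occ x (idx A n) k := by
  unfold urnsAtLeast occ
  congr 1
  ext i
  have h : ballsIn x (dilate n A) i = ((idx A n).filter fun m => x m = i : Finset ℕ+) := by
    ext m
    simp [ballsIn, mem_idx hA]
  simp only [Set.mem_ofPred_eq, h, Set.encard_coe_eq_coe_finsetCard, Nat.cast_le]
  -- The condition i ≥ 1 is automatic: since k ≥ 1 the urn is nonempty, and labels are positive.
  refine ⟨fun h => h.2, fun h => ⟨?_, h⟩⟩
  obtain ⟨m, hm⟩ := Finset.card_pos.1 (lt_of_lt_of_le hk h)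
  rw [← (Finset.mem_filter.1 hm).2]
  exact hx m

/-- The index set `nA` has at least linear growth. -/
lemma exists_mul_le_card_idx {A : Set ℝ} (hA : IsFiniteUnionOfIntervals A) (hA0 : 0 < volume A) :
    ∃ c : ℝ, 0 < c ∧ ∀ᶠ n : ℕ in atTop, c * n ≤ (idx A n).card := by
  have hsub := hA.subset_Icc
  obtain ⟨F, hfin, hF, rfl⟩ := hA
  obtain ⟨I, hI, hI0⟩ : ∃ I ∈ F, volume I ≠ 0 := by
    by_contra! h
    exact hA0.ne' ((measure_sUnion_null_iff hfin.countable).2 h)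
  have hnt : ¬ I.Subsingleton := fun h => hI0 (h.measure_zero volume)
  rw [Set.not_subsingleton_iff] at hnt
  obtain ⟨a, ha, b, hb, hab⟩ := hnt.exists_lt
  have hIcc : Set.Icc a b ⊆ I := (hF I hI).1.out ha hb
  have ha0 : 0 ≤ a := ((hF I hI).2 ha).1
  have hba : 0 < b - a := sub_pos.2 hab
  refine ⟨(b - a) / 2, by positivity, ?_⟩
  filter_upwards [eventually_gt_atTop 0,
    tendsto_natCast_atTop_atTop.eventually (eventually_ge_atTop (2 / (b - a)))] with n hn hn2
  have hn' : (0 : ℝ) < n := by exact_mod_cast hn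
  have h1 : (n : ℝ) * b - n * a - 1 ≤ (idx (⋃₀ F) n).card := by
    refine le_card_of_forall_mem_Ioo (by positivity) fun m h1 h2 => ?_
    rw [mem_idx_iff_div_mem hsub hn]
    refine Set.mem_sUnion.2 ⟨I, hI, hIcc ⟨?_, ?_⟩⟩
    · rw [le_div_iff₀ hn']; linarith
    · rw [div_le_iff₀ hn']; linarith
  rw [div_le_iff₀ hba] at hn2
  linarith

/-- The indices that lie in `nA` for some `n` between `a` and `b`. -/
noncomputable def upperIdx (A : Set ℝ) (a b : ℕ) : Finset ℕ+ := (Finset.Icc a b).biUnion (idx A)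

/-- The indices that lie in `nA` for all `n` between `a` and `b`. -/
noncomputable def lowerIdx (A : Set ℝ) (a b : ℕ) : Finset ℕ+ :=
  (idx A a).filter fun m => ∀ n ∈ Finset.Icc a b, m ∈ idx A n

lemma idx_subset_upperIdx (A : Set ℝ) {a b n : ℕ} (ha : a ≤ n) (hb : n ≤ b) :
    idx A n ⊆ upperIdx A a b :=
  Finset.subset_biUnion_of_mem (idx A) (Finset.mem_Icc.2 ⟨ha, hb⟩)

lemma lowerIdx_subset_idx (A : Set ℝ) {a b n : ℕ} (ha : a ≤ n) (hb : n ≤ b) :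
    lowerIdx A a b ⊆ idx A n :=
  fun _ hm => (Finset.mem_filter.1 hm).2 n (Finset.mem_Icc.2 ⟨ha, hb⟩)

/-- If the ratio of a point to `n` lies in an interval and the ratio to `n'` does not, then the
point is close to a dilated endpoint of the interval. -/
lemma near_endpoint {I : Set ℝ} (hI : I.OrdConnected) (hI1 : I ⊆ Set.Icc 0 1) {a b n n' t : ℝ}
    (ha : 0 < a) (hn : n ∈ Set.Icc a b) (hn' : n' ∈ Set.Icc a b) (h : t / n ∈ I)
    (h' : t / n' ∉ I) :
    (a * sInf I ≤ t ∧ t ≤ b * sInf I) ∨ (a * sSup I ≤ t ∧ t ≤ b * sSup I) := by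
  have hbelow : BddBelow I := ⟨0, fun x hx => (hI1 hx).1⟩
  have habove : BddAbove I := ⟨1, fun x hx => (hI1 hx).2⟩
  have h0 : 0 < n := ha.trans_le hn.1
  have h0' : 0 < n' := ha.trans_le hn'.1
  have hinf0 : 0 ≤ sInf I := le_csInf ⟨_, h⟩ fun x hx => (hI1 hx).1
  have hsup0 : 0 ≤ sSup I := (hI1 h).1.trans (le_csSup habove h)
  have e1 := csInf_le hbelow h
  have e2 := le_csSup habove h
  rw [le_div_iff₀ h0] at e1
  rw [div_le_iff₀ h0] at e2
  rcases le_total (t / n') (t / n) with hlt | hlt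
  · left
    have e3 : t / n' ≤ sInf I := by
      by_contra! hlt'
      obtain ⟨y, hy, hy'⟩ := exists_lt_of_csInf_lt ⟨_, h⟩ hlt'
      exact h' (hI.out hy h ⟨hy'.le, hlt⟩)
    rw [div_le_iff₀ h0'] at e3
    constructor
    · nlinarith [mul_le_mul_of_nonneg_right hn.1 hinf0]
    · nlinarith [mul_le_mul_of_nonneg_right hn'.2 hinf0]
  · right
    have e3 : sSup I ≤ t / n' := by
      by_contra! hlt'
      obtain ⟨y, hy, hy'⟩ := exists_lt_of_lt_csSup ⟨_, h⟩ hlt'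
      exact h' (hI.out h hy ⟨hlt, hy'.le⟩)
    rw [le_div_iff₀ h0'] at e3
    constructor
    · nlinarith [mul_le_mul_of_nonneg_right hn'.1 hsup0]
    · nlinarith [mul_le_mul_of_nonneg_right hn.2 hsup0]

/-- An index in some but not all of the dilations lies in [a c, b c] for an endpoint c ∈ [0, 1] of
one of the intervals. There are at most two endpoints per interval, each accounting for at most b -
a + 1 integers. -/
lemma exists_card_upperIdx_le {A : Set ℝ} (hA : IsFiniteUnionOfIntervals A) :
    ∃ K : ℝ, 0 < K ∧ ∀ a b : ℕ, 0 < a → a ≤ b →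
      ((upperIdx A a b).card : ℝ) ≤ (lowerIdx A a b).card + K * ((b : ℝ) - a + 1) := by
  classical
  have hsub := hA.subset_Icc
  obtain ⟨F, hfin, hF, rfl⟩ := hA
  -- The extra 1 only keeps the constant positive when the family is empty.
  refine ⟨2 * hfin.toFinset.card + 1, by positivity, fun a b ha hab => ?_⟩
  set U := upperIdx (⋃₀ F) a b
  set D := lowerIdx (⋃₀ F) a b
  have ha' : (0 : ℝ) < a := by exact_mod_cast ha
  have hab' : (a : ℝ) ≤ b := by exact_mod_cast hab
  let near (c : ℝ) : Finset ℕ+ := U.filter fun m => (a : ℝ) * c ≤ m ∧ (m : ℝ) ≤ b * c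
  have hnear (c : ℝ) (h0 : 0 ≤ c) (h1 : c ≤ 1) : ((near c).card : ℝ) ≤ (b : ℝ) - a + 1 := by
    have := card_le_of_forall_mem_Icc (s := near c) (u := a * c) (v := b * c) (by positivity)
      (by gcongr) fun m hm => (Finset.mem_filter.1 hm).2
    nlinarith
  have hcover : U ⊆ D ∪ hfin.toFinset.biUnion fun I => near (sInf I) ∪ near (sSup I) := by
    intro m hm
    rw [Finset.mem_union]
    by_cases hmD : m ∈ D
    · exact Or.inl hmD
    right
    obtain ⟨n, hn, hmn⟩ := Finset.mem_biUnion.1 hm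
    have hn := Finset.mem_Icc.1 hn
    obtain ⟨n', hn', hmn'⟩ : ∃ n' ∈ Finset.Icc a b, m ∉ idx (⋃₀ F) n' := by
      by_contra! h
      exact hmD (Finset.mem_filter.2 ⟨h a (Finset.mem_Icc.2 ⟨le_rfl, hab⟩), h⟩)
    have hn' := Finset.mem_Icc.1 hn'
    rw [mem_idx_iff_div_mem hsub (by omega)] at hmn hmn'
    obtain ⟨I, hI, hmI⟩ := hmn
    have hmI' : (m : ℝ) / n' ∉ I := fun h => hmn' ⟨I, hI, h⟩
    have := near_endpoint (hF I hI).1 (hF I hI).2 (n := n) (n' := n') (b := b) ha'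
      ⟨by exact_mod_cast hn.1, by exact_mod_cast hn.2⟩
      ⟨by exact_mod_cast hn'.1, by exact_mod_cast hn'.2⟩ hmI hmI'
    refine Finset.mem_biUnion.2 ⟨I, hfin.mem_toFinset.2 hI, Finset.mem_union.2 ?_⟩
    exact this.imp (fun h => Finset.mem_filter.2 ⟨hm, h⟩) fun h => Finset.mem_filter.2 ⟨hm, h⟩
  have hcard : (U.card : ℝ) ≤ D.card +
      ∑ I ∈ hfin.toFinset, (((near (sInf I)).card : ℝ) + (near (sSup I)).card) := by
    have h1 := (Finset.card_le_card hcover).trans ((Finset.card_union_le _ _).trans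
      (Nat.add_le_add_left (Finset.card_biUnion_le.trans
        (Finset.sum_le_sum fun I _ => Finset.card_union_le _ _)) _))
    exact_mod_cast h1
  have hsum : ∑ I ∈ hfin.toFinset, (((near (sInf I)).card : ℝ) + (near (sSup I)).card) ≤
      ∑ _I ∈ hfin.toFinset, 2 * ((b : ℝ) - a + 1) := by
    refine Finset.sum_le_sum fun I hI => ?_
    have hI1 := (hF I (hfin.mem_toFinset.1 hI)).2
    have h1 := hnear (sInf I) (Real.sInf_nonneg fun x hx => (hI1 hx).1) <| by
      rcases I.eq_empty_or_nonempty with rfl | ⟨x, hx⟩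
      · simp
      · exact (csInf_le ⟨0, fun y hy => (hI1 hy).1⟩ hx).trans (hI1 hx).2
    have h2 := hnear (sSup I) (Real.sSup_nonneg fun x hx => (hI1 hx).1)
      (Real.sSup_le (fun x hx => (hI1 hx).2) zero_le_one)
    linarith
  rw [Finset.sum_const, nsmul_eq_mul] at hsum
  linarith

end UrnScheme

/-! ### Polynomial blocks, interpolation and the strong law -/

namespace UrnScheme

lemma tendsto_pow_succ_sub_div {r : ℕ} (hr : 1 ≤ r) :
    Tendsto (fun j : ℕ => (((j : ℝ) + 1) ^ r - (j : ℝ) ^ r + 1) / (j : ℝ) ^ r) atTop (𝓝 0) := by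
  have h1 : Tendsto (fun j : ℕ => (1 : ℝ) / j) atTop (𝓝 0) := tendsto_one_div_atTop_nhds_zero_nat
  have h2 := (((h1.const_add 1).pow r).sub_const 1).add (h1.pow r)
  have h3 : ((1 : ℝ) + 0) ^ r - 1 + 0 ^ r = 0 := by simp; omega
  rw [h3] at h2
  refine h2.congr' ?_
  filter_upwards [eventually_gt_atTop 0] with j hj
  have hj' : (0 : ℝ) < j := by exact_mod_cast hj
  have h4 : 1 + 1 / (j : ℝ) = (j + 1) / j := by field_simp
  rw [h4, div_pow, div_pow, one_pow]
  field_simp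

/-- The integer part of the `r`-th root. -/
lemma exists_tendsto_root {r : ℕ} (hr : 1 ≤ r) : ∃ g : ℕ → ℕ, Tendsto g atTop atTop ∧
    ∀ n, g n ^ r ≤ n ∧ n ≤ (g n + 1) ^ r := by
  refine ⟨fun n => Nat.findGreatest (fun j => j ^ r ≤ n) n, ?_, fun n => ⟨?_, ?_⟩⟩
  · refine tendsto_atTop.2 fun j => ?_
    filter_upwards [eventually_ge_atTop (j ^ r)] with n hn
    exact Nat.le_findGreatest ((Nat.le_self_pow (by omega) j).trans hn) hn
  · exact Nat.findGreatest_spec (P := fun j => j ^ r ≤ n) (Nat.zero_le n)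
      (by rw [zero_pow (by omega)]; exact Nat.zero_le n)
  · by_contra! h
    have h1 := (Nat.le_self_pow (show r ≠ 0 by omega) _).trans h.le
    have := Nat.le_findGreatest (P := fun j => j ^ r ≤ n) h1 h.le
    omega

/-- The cardinalities of the upper and lower index sets along the blocks
`[j ^ r, (j + 1) ^ r]` are asymptotically equal and grow at least like `j ^ r`. -/
lemma card_lowerIdx_asymptotics {A : Set ℝ} (hA : IsFiniteUnionOfIntervals A)
    (hA0 : 0 < volume A) {r : ℕ} (hr : 1 ≤ r) :
    Tendsto (fun j : ℕ => ((lowerIdx A (j ^ r) ((j + 1) ^ r)).card : ℝ) /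
      (upperIdx A (j ^ r) ((j + 1) ^ r)).card) atTop (𝓝 1) ∧
    ∃ c : ℝ, 0 < c ∧ ∀ᶠ j : ℕ in atTop,
      c * (j : ℝ) ^ r ≤ (lowerIdx A (j ^ r) ((j + 1) ^ r)).card := by
  set U := fun j : ℕ => upperIdx A (j ^ r) ((j + 1) ^ r)
  set D := fun j : ℕ => lowerIdx A (j ^ r) ((j + 1) ^ r)
  have hblock (j : ℕ) : j ^ r ≤ (j + 1) ^ r := Nat.pow_le_pow_left (by omega) r
  obtain ⟨c, hc, hcard⟩ := exists_mul_le_card_idx hA hA0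
  obtain ⟨K, hK, hUD⟩ := exists_card_upperIdx_le hA
  have hU : ∀ᶠ j : ℕ in atTop, c * (j : ℝ) ^ r ≤ (U j).card := by
    filter_upwards [(tendsto_pow_atTop (α := ℕ) (show r ≠ 0 by omega)).eventually hcard] with j hj
    push_cast at hj
    exact hj.trans (by exact_mod_cast
      Finset.card_le_card (idx_subset_upperIdx A le_rfl (hblock j)))
  have hδ := (tendsto_pow_succ_sub_div hr).const_mul (K / c)
  have hratio : Tendsto (fun j : ℕ => ((D j).card : ℝ) / (U j).card) atTop (𝓝 1) := by
    have h1 := hδ.const_sub 1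
    rw [mul_zero, sub_zero] at h1
    refine tendsto_of_tendsto_of_tendsto_of_le_of_le' h1 tendsto_const_nhds ?_ ?_
    · filter_upwards [hU, eventually_gt_atTop 0] with j hj hj0
      have hj1 : (0 : ℝ) < (j : ℝ) ^ r := by positivity
      have hU0 : (0 : ℝ) < (U j).card := lt_of_lt_of_le (by positivity) hj
      have h2 := hUD (j ^ r) ((j + 1) ^ r) (by positivity) (hblock j)
      push_cast at h2
      have h4 : (j : ℝ) ^ r ≤ ((j : ℝ) + 1) ^ r := by gcongr; linarith
      set δ := ((j : ℝ) + 1) ^ r - (j : ℝ) ^ r + 1 with hδ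
      have h5 : 0 ≤ δ := by linarith
      rw [le_div_iff₀ hU0]
      have h3 : K * δ ≤ K / c * (δ / (j : ℝ) ^ r) * (U j).card := by
        calc K * δ = K / c * (δ / (j : ℝ) ^ r) * (c * (j : ℝ) ^ r) := by field_simp
          _ ≤ _ := by gcongr
      linarith
    · refine Eventually.of_forall fun j => div_le_one_of_le₀ ?_ (Nat.cast_nonneg _)
      exact_mod_cast Finset.card_le_card ((lowerIdx_subset_idx A le_rfl (hblock j)).trans
        (idx_subset_upperIdx A le_rfl (hblock j)))
  refine ⟨hratio, c / 2, by positivity, ?_⟩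
  filter_upwards [hU, eventually_gt_atTop 0,
    hratio.eventually (lt_mem_nhds (show (1 / 2 : ℝ) < 1 by norm_num))] with j hj hj0 h2
  have hj1 : (0 : ℝ) < (j : ℝ) ^ r := by positivity
  have hU0 : (0 : ℝ) < (U j).card := lt_of_lt_of_le (by positivity) hj
  rw [lt_div_iff₀ hU0] at h2
  linarith

lemma tendsto_card_of_le {N : ℕ → ℕ} {c : ℝ} (hc : 0 < c) {r : ℕ} (hr : 1 ≤ r)
    (h : ∀ᶠ j : ℕ in atTop, c * (j : ℝ) ^ r ≤ N j) : Tendsto N atTop atTop := by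
  rw [← tendsto_natCast_atTop_iff (R := ℝ)]
  refine tendsto_atTop_mono' _ h (Tendsto.const_mul_atTop hc ?_)
  exact (tendsto_pow_atTop (by omega)).comp tendsto_natCast_atTop_atTop

/-- Squeeze the ratio between 1, by monotonicity, and (U / (D + 1 - k))^k, by `meanOcc_le_mul_pow`.
-/
lemma IsUrnProb.tendsto_meanOcc_div {p : ℕ → ℝ} (hp : IsUrnProb p) {k : ℕ} (hk : 1 ≤ k)
    {D U : ℕ → ℕ} (hDU : ∀ j, D j ≤ U j) (hD : Tendsto D atTop atTop)
    (hratio : Tendsto (fun j => (D j : ℝ) / U j) atTop (𝓝 1))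
    (hpos : ∀ᶠ n in atTop, 0 < meanOcc p k n) :
    Tendsto (fun j => meanOcc p k (U j) / meanOcc p k (D j)) atTop (𝓝 1) := by
  have hU : Tendsto U atTop atTop := tendsto_atTop_mono hDU hD
  have h1 : Tendsto (fun j => ((U j : ℝ) / (D j + 1 - k)) ^ k) atTop (𝓝 1) := by
    have h2 : Tendsto (fun j => (1 - (k : ℝ)) / U j) atTop (𝓝 0) :=
      (tendsto_natCast_atTop_atTop.comp hU).const_div_atTop _
    have h3 := ((hratio.add h2).inv₀ (by norm_num)).pow k
    simp only [add_zero, inv_one, one_pow] at h3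
    refine h3.congr fun j => ?_
    rw [← add_div, inv_div, add_sub_assoc]
  refine tendsto_of_tendsto_of_tendsto_of_le_of_le' tendsto_const_nhds h1 ?_ ?_
  · filter_upwards [hD.eventually hpos] with j hj
    rw [one_le_div hj]
    exact hp.meanOcc_mono hk (hDU j)
  · filter_upwards [hD.eventually hpos, hD.eventually (eventually_ge_atTop k)] with j hj hj2
    rw [div_le_iff₀' hj]
    exact hp.meanOcc_le_mul_pow hk hj2 (hDU j)

variable {Ω : Type*} [MeasurableSpace Ω] {μ : Measure Ω} {X : ℕ+ → Ω → ℕ}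

lemma IsUrnScheme.RStar_eq (hX : IsUrnScheme μ X) {A : Set ℝ} (hA : A ⊆ Set.Icc 0 1) {k : ℕ}
    (hk : 1 ≤ k) (n : ℕ) (ω : Ω) : RStar X A k n ω = occ (fun m => X m ω) (idx A n) k := by
  rw [RStar, urnsAtLeast_dilate hA (fun m => hX.pos m ω) hk]

variable [IsProbabilityMeasure μ]

/-- The strong law of large numbers for the number of urns with at least `k` balls. -/
lemma IsUrnScheme.ae_tendsto_occ_idx_div (hX : IsUrnScheme μ X) {θ : ℝ} (hθ : 0 < θ)
    (hreg : RegularCondition (urnProb μ X) θ) {k : ℕ} (hk : 1 ≤ k) {A : Set ℝ}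
    (hA : IsFiniteUnionOfIntervals A) (hA0 : 0 < volume A) :
    ∀ᵐ ω ∂μ, Tendsto (fun n => (occ (fun m => X m ω) (idx A n) k : ℝ) /
      meanOcc (urnProb μ X) k (idx A n).card) atTop (𝓝 1) := by
  have hp := hX.isUrnProb
  set p := urnProb μ X
  -- The mean grows at least like n^(θ/2), so n = j^r with r θ/2 ≥ 2 makes it at least of order j²,
  -- with summable reciprocals.
  obtain ⟨r, hr⟩ := exists_nat_ge (4 / θ)
  have hrθ : 2 ≤ r * (θ / 2) := by
    rw [div_le_iff₀ hθ] at hr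
    linarith
  have hr1 : 1 ≤ r := by
    have : (0 : ℝ) < r := (by positivity : 0 < 4 / θ).trans_le hr
    exact_mod_cast this
  obtain ⟨hratio, c, hc, hD⟩ := card_lowerIdx_asymptotics hA hA0 hr1
  set U := fun j : ℕ => upperIdx A (j ^ r) ((j + 1) ^ r)
  set D := fun j : ℕ => lowerIdx A (j ^ r) ((j + 1) ^ r)
  have hblock (j : ℕ) : j ^ r ≤ (j + 1) ^ r := Nat.pow_le_pow_left (by omega) r
  have hDU (j : ℕ) : (D j).card ≤ (U j).card :=
    Finset.card_le_card ((lowerIdx_subset_idx A le_rfl (hblock j)).trans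
      (idx_subset_upperIdx A le_rfl (hblock j)))
  have hDtop := tendsto_card_of_le hc hr1 hD
  obtain ⟨d, hd, hgrow⟩ := hp.exists_rpow_le_meanOcc hθ hreg hk
  have hpos : ∀ᶠ n in atTop, 0 < meanOcc p k n := by
    filter_upwards [hgrow, eventually_gt_atTop 0] with n hn hn0
    have : (0 : ℝ) < n := by exact_mod_cast hn0
    exact lt_of_lt_of_le (by positivity) hn
  have hfD : ∀ᶠ j : ℕ in atTop, d * c ^ (θ / 2) * (j : ℝ) ^ 2 ≤ meanOcc p k (D j).card := by
    filter_upwards [hD, hDtop.eventually hgrow, eventually_ge_atTop 1] with j h1 h2 h3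
    have hj : (1 : ℝ) ≤ j := by exact_mod_cast h3
    refine le_trans ?_ h2
    rw [mul_assoc]
    gcongr
    calc c ^ (θ / 2) * (j : ℝ) ^ 2 ≤ c ^ (θ / 2) * ((j : ℝ) ^ r) ^ (θ / 2) := by
          gcongr
          rw [← Real.rpow_natCast, ← Real.rpow_natCast, ← Real.rpow_mul (by positivity)]
          exact Real.rpow_le_rpow_of_exponent_le hj (by exact_mod_cast hrθ)
      _ = (c * (j : ℝ) ^ r) ^ (θ / 2) := by rw [Real.mul_rpow (by positivity) (by positivity)]
      _ ≤ _ := by gcongr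
  have hfU : ∀ᶠ j : ℕ in atTop, d * c ^ (θ / 2) * (j : ℝ) ^ 2 ≤ meanOcc p k (U j).card :=
    hfD.mono fun j hj => hj.trans (hp.meanOcc_mono hk (hDU j))
  have hUDratio := hp.tendsto_meanOcc_div hk hDU hDtop hratio hpos
  obtain ⟨g, hg, hgn⟩ := exists_tendsto_root hr1
  filter_upwards [hX.ae_tendsto_occ_div hk D (by positivity) hfD,
    hX.ae_tendsto_occ_div hk U (by positivity) hfU] with ω hω1 hω2
  -- Multiplying by the ratio of means turns the two limits into those of occ(D) / f_k(U) and occ(U)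
  -- / f_k(D), which enclose the desired quotient.
  have hlow := (hω1.mul (hUDratio.inv₀ one_ne_zero)).comp hg
  have hupp := (hω2.mul hUDratio).comp hg
  simp only [inv_one, mul_one] at hlow hupp
  have hposD := hg.eventually (hDtop.eventually hpos)
  refine tendsto_of_tendsto_of_tendsto_of_le_of_le' hlow hupp ?_ ?_
  · filter_upwards [hposD] with n hn
    have hs1 := lowerIdx_subset_idx A (hgn n).1 (hgn n).2
    have hs2 := idx_subset_upperIdx A (hgn n).1 (hgn n).2
    have hm1 := hp.meanOcc_mono hk (Finset.card_le_card hs1)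
    have hm2 := hp.meanOcc_mono hk (Finset.card_le_card hs2)
    have hN := hn.trans_le hm1
    simp only [Function.comp_apply]
    rw [inv_div, div_mul_div_cancel₀ hn.ne']
    gcongr
    exact occ_mono _ hs1 hk
  · filter_upwards [hposD] with n hn
    have hs1 := lowerIdx_subset_idx A (hgn n).1 (hgn n).2
    have hs2 := idx_subset_upperIdx A (hgn n).1 (hgn n).2
    have hm1 := hp.meanOcc_mono hk (Finset.card_le_card hs1)
    have hm2 := hp.meanOcc_mono hk (Finset.card_le_card hs2)
    have hN := hn.trans_le (hm1.trans hm2)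
    simp only [Function.comp_apply]
    rw [div_mul_div_cancel₀ hN.ne']
    gcongr
    exact occ_mono _ hs2 hk

lemma IsUrnScheme.integral_RStar (hX : IsUrnScheme μ X) {A : Set ℝ} (hA : A ⊆ Set.Icc 0 1) {k : ℕ}
    (hk : 1 ≤ k) (n : ℕ) :
    ∫ ω, RStar X A k n ω ∂μ = meanOcc (urnProb μ X) k (idx A n).card := by
  simp only [hX.RStar_eq hA hk]
  exact hX.integral_occ _ hk

lemma IsUrnScheme.integral_RExact (hX : IsUrnScheme μ X) {A : Set ℝ} (hA : A ⊆ Set.Icc 0 1)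
    {k : ℕ} (hk : 1 ≤ k) (n : ℕ) :
    ∫ ω, RExact X A k n ω ∂μ = meanOcc (urnProb μ X) k (idx A n).card -
      meanOcc (urnProb μ X) (k + 1) (idx A n).card := by
  have hk' : 1 ≤ k + 1 := by omega
  simp only [RExact, hX.RStar_eq hA hk, hX.RStar_eq hA hk']
  rw [integral_sub (hX.integrable_occ _ hk) (hX.integrable_occ _ hk'), hX.integral_occ _ hk,
    hX.integral_occ _ hk']

/-- Differences of asymptotically equivalent sequences are asymptotically equivalent when no
cancellation occurs. -/
lemma tendsto_sub_div_sub {a b f g : ℕ → ℝ} {C : ℝ}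
    (ha : Tendsto (fun n => a n / f n) atTop (𝓝 1)) (hb : Tendsto (fun n => b n / g n) atTop (𝓝 1))
    (hg : ∀ᶠ n in atTop, 0 < g n) (hgf : ∀ᶠ n in atTop, g n ≤ f n)
    (hC : ∀ᶠ n in atTop, f n ≤ C * (f n - g n)) :
    Tendsto (fun n => (a n - b n) / (f n - g n)) atTop (𝓝 1) := by
  rw [tendsto_iff_norm_sub_tendsto_zero] at ha hb ⊢
  have hlim := (ha.const_mul C).add (hb.const_mul C)
  rw [mul_zero, add_zero] at hlim
  refine squeeze_zero' (Eventually.of_forall fun n => norm_nonneg _) ?_ hlim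
  filter_upwards [hg, hgf, hC] with n hg hgf hC
  have hf := hg.trans_le hgf
  have he : 0 < f n - g n := by
    refine lt_of_le_of_ne (sub_nonneg.2 hgf) fun h => ?_
    rw [← h] at hC
    linarith
  -- The relative error of the difference combines the two relative errors with coefficients that
  -- `hC` bounds by C in absolute value.
  have e : (a n - b n) / (f n - g n) - 1 =
      f n / (f n - g n) * (a n / f n - 1) - g n / (f n - g n) * (b n / g n - 1) := by
    field_simp
    ring
  have h1 : f n / (f n - g n) ≤ C := (div_le_iff₀ he).2 hC
  have h2 : g n / (f n - g n) ≤ C := (div_le_iff₀ he).2 (hgf.trans hC)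
  rw [e]
  refine (norm_sub_le _ _).trans ?_
  rw [norm_mul, norm_mul, Real.norm_of_nonneg (div_pos hf he).le,
    Real.norm_of_nonneg (div_pos hg he).le]
  gcongr

end UrnScheme

theorem mainTheorem3 {Ω : Type*} [MeasurableSpace Ω] (μ : Measure Ω) [IsProbabilityMeasure μ]
    (X : ℕ+ → Ω → ℕ) (hX : UrnScheme.IsUrnScheme μ X)
    (θ : ℝ) (hθ : 0 < θ) (hreg : UrnScheme.RegularCondition (UrnScheme.urnProb μ X) θ)
    (k : ℕ) (hk : 1 ≤ k)
    (A : Set ℝ) (hA : UrnScheme.IsFiniteUnionOfIntervals A) (hA0 : 0 < volume A) :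
    (∀ᵐ ω ∂μ, Tendsto
      (fun n : ℕ => UrnScheme.RStar X A k n ω / ∫ ω', UrnScheme.RStar X A k n ω' ∂μ)
      atTop (𝓝 1)) ∧
    (∀ᵐ ω ∂μ, Tendsto
      (fun n : ℕ => UrnScheme.RExact X A k n ω / ∫ ω', UrnScheme.RExact X A k n ω' ∂μ)
      atTop (𝓝 1)) := by
  have hsub := hA.subset_Icc
  have hp := hX.isUrnProb
  have hk' : 1 ≤ k + 1 := by omega
  have h1 := hX.ae_tendsto_occ_idx_div hθ hreg hk hA hA0
  have h2 := hX.ae_tendsto_occ_idx_div hθ hreg hk' hA hA0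
  simp only [hX.integral_RStar hsub hk, hX.integral_RExact hsub hk]
  simp only [UrnScheme.RExact, hX.RStar_eq hsub hk, hX.RStar_eq hsub hk']
  refine ⟨h1, ?_⟩
  obtain ⟨c, hc, hcard⟩ := UrnScheme.exists_mul_le_card_idx hA hA0
  have htop : Tendsto (fun n => (UrnScheme.idx A n).card) atTop atTop :=
    UrnScheme.tendsto_card_of_le hc le_rfl (by simpa using hcard)
  obtain ⟨d, hd, hgrow⟩ := hp.exists_rpow_le_meanOcc hθ hreg hk'
  obtain ⟨C, -, hC⟩ := hp.exists_meanOcc_le_mul_sub hθ hreg hk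
  have hpos : ∀ᶠ n in atTop, 0 < UrnScheme.meanOcc (UrnScheme.urnProb μ X) (k + 1) n := by
    filter_upwards [hgrow, eventually_gt_atTop 0] with n hn hn0
    have : (0 : ℝ) < n := by exact_mod_cast hn0
    exact lt_of_lt_of_le (by positivity) hn
  filter_upwards [h1, h2] with ω hω1 hω2
  exact UrnScheme.tendsto_sub_div_sub hω1 hω2 (htop.eventually hpos)
    (Eventually.of_forall fun n => hp.meanOcc_succ_le hk _) (htop.eventually hC)
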